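/- Theorem 6.1. Write $\mathbb C^{+}=\{\operatorname{Im} z>0\}$, $\mathbb C^{-}=\{\operatorname{Im} z<0\}$ and $\lambda_\pm(z)=z\pm i$. For $1\le p<\infty$ let $H^p(\mathbb C^\pm)$ be the space of analytic functions $F$ on $\mathbb C^\pm$ with $\sup_{y>0}\int_{\mathbb R}|F(x\pm iy)|^p\,dx<\infty$, let $H_p^\pm\subset L_p(\mathbb R)$ be the space of nontangential boundary functions on $\mathbb R$ of the functions in $H^p(\mathbb C^\pm)$, and let $\mathcal H_p^\pm=\lambda_\pm H_p^\pm$. If $g=\lambda_\pm f\in\mathcal H_p^\pm$, where $f\in H_p^\pm$ is the boundary function of $F\in H^p(\mathbb C^\pm)$, then $\lambda_\pm F$ is called the analytic extension of $g$ to $\mathbb C^\pm$. Let $1<p<\infty$, $\frac1p+\frac1{p'}=1$, and let $g_\pm$ be functions on $\mathbb R$, nonzero almost everywhere, with $$g_\pm\in\mathcal H_{p'}^\pm,\qquad g_\pm^{-1}\in\mathcal H_p^\pm .$$ Then $\log g_\pm\in\mathcal H_2^\pm$, in the following sense (for each of the two signs separately): if $G_\pm$ is the analytic extension of $g_\pm$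 to $\mathbb C^\pm$, then there is an analytic function $L$ on $\mathbb C^\pm$ with $e^{L}=G_\pm$ (an analytic branch of $\log G_\pm$), and every such $L$ is the analytic extension to $\mathbb C^\pm$ of a function $\ell\in\mathcal H_2^\pm$ with $e^{\ell}=g_\pm$ almost everywhere on $\mathbb R$. -/

import Mathlib

open MeasureTheory Filter Topology

namespace HalfPlaneHardy

/-- The two sides of the real line, i.e. the value of the symbol `±`. -/
inductive Side
  | plus
  | minus

/-- The number `+1` or `-1`. -/
def Side.sign : Side → ℝ
  | .plus => 1
  | .minus => -1

/-- The open half-plane `ℂ⁺ = {Im z > 0}` or `ℂ⁻ = {Im z < 0}`. -/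
def halfPlane (s : Side) : Set ℂ := {z | 0 < s.sign * z.im}

/-- The function `λ_±(z) = z ± i`; it has no zero on the real line nor in the half-plane `ℂ^±`. -/
def lam (s : Side) (z : ℂ) : ℂ := z + s.sign * Complex.I

/-- `F` lies in the Hardy space `H^p(ℂ^±)` of analytic functions on the half-plane with
`sup_{y > 0} ∫ |F(x ± iy)|^p dx < ∞`. (Only the values of `F` on `ℂ^±` matter.) -/
def IsHardy (s : Side) (p : ℝ) (F : ℂ → ℂ) : Prop :=
  DifferentiableOn ℂ F (halfPlane s) ∧
    ∃ C : NNReal, ∀ y : ℝ, 0 < y →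
      ∫⁻ x : ℝ, ‖F ((x : ℂ) + (s.sign * y : ℝ) * Complex.I)‖ₑ ^ p ≤ C

/-- The cone in `ℂ^±` with vertex `x ∈ ℝ` and aperture `a`. -/
def cone (s : Side) (a x : ℝ) : Set ℂ := {z | z ∈ halfPlane s ∧ |z.re - x| < a * |z.im|}

/-- `F` has the nontangential limit `c` at the point `x ∈ ℝ`, from within `ℂ^±`. -/
def HasNontangentialLimit (s : Side) (F : ℂ → ℂ) (x : ℝ) (c : ℂ) : Prop :=
  ∀ a : ℝ, 0 < a → Tendsto F (𝓝[cone s a x] (x : ℂ)) (𝓝 c)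

/-- `f ∈ L_p(ℝ)` is the nontangential boundary function of `F ∈ H^p(ℂ^±)`; that is, `f` is an
element of the subspace `H_p^±` of `L_p` and `F` is its analytic extension to `ℂ^±`. -/
def IsHardyExtension (s : Side) (p : ℝ) (F : ℂ → ℂ) (f : ℝ → ℂ) : Prop :=
  IsHardy s p F ∧ MemLp f (ENNReal.ofReal p) volume ∧
    ∀ᵐ x : ℝ, HasNontangentialLimit s F x (f x)

/-- `g` is an element of the space `𝓗_p^± = λ_± H_p^±` of functions on `ℝ`, and `G` is its
analytic extension to `ℂ^±`. -/
def IsScriptHExtension (s : Side) (p : ℝ) (G : ℂ → ℂ) (g : ℝ → ℂ) : Prop :=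
  IsHardyExtension s p (fun z => G z / lam s z) (fun x => g x / lam s x)

/-- `g ∈ 𝓗_p^± = λ_± H_p^±`, as a function on `ℝ` (up to null sets). -/
def MemScriptH (s : Side) (p : ℝ) (g : ℝ → ℂ) : Prop :=
  ∃ G : ℂ → ℂ, IsScriptHExtension s p G g

/-- `L` is an analytic branch of `log G` in the half-plane `ℂ^±`. -/
def IsLogBranch (s : Side) (G L : ℂ → ℂ) : Prop :=
  DifferentiableOn ℂ L (halfPlane s) ∧ ∀ z ∈ halfPlane s, Complex.exp (L z) = G z

end HalfPlaneHardy

/-! Let `K` be the extension of `1 / g`. By Hölder `G * K / λ²` is in `H¹`, and so is `λ⁻²`; they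
share boundary values, so uniqueness in `H¹` (`IsHardy.eq_zero_of_nontangentialLimit`, proved from
Jensen's inequality) gives `G * K = 1`. Thus `G` has no zeros on a convex domain and a branch `L` of
its logarithm exists.

Hölder against `1 / λ` also puts `e^L / λ²` and `e^(-L) / λ²` in `H¹`. Since `u² ≤ 2 (e^u +
e^(-u))`, this bounds `∫ (Re L)² / |λ|²` over horizontal lines (`lintegral_re_sq_le_of_exp_hardy`).
To recover `Im L`, write `|f|² = 2 (Re f)² - Re f²`: the Poisson mean of `Re f²` is its value at
`i`, so only `Im f(i)` is needed besides `Re f` (`lintegral_norm_sq_le_of_re_sq_le`). For the line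
at height `y` this is applied to `f(z) = L((1+y)z + iy)`. The change of variables gains a factor
`1/(1+y)`, so the growth `|L(it)| ≤ D √t` of `norm_mul_I_le_of_exp_hardy` suffices for a bound
uniform in `y`, and `L / λ` is in `H²`.

Finally, inside a small cone at `x` the branch differs from the principal `log (G / g x)` by a
constant, so `L` has nontangential limits whose exponential is `g`; Fatou makes them square
integrable after division by `λ`. -/

namespace HalfPlaneHardy

/-! ### Cayley transform: circle averages as Poisson integrals at `i`. -/

/-- The Cayley transform of the unit disc onto the upper half-plane. -/
noncomputable def cayley (w : ℂ) : ℂ := Complex.I * (1 + w) / (1 - w)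

/-- The point of the unit circle which the Cayley transform sends to `x ∈ ℝ`. -/
noncomputable def circlePoint (x : ℝ) : ℂ := (x - Complex.I) / (x + Complex.I)

lemma ofReal_add_I_ne_zero (x : ℝ) : (x : ℂ) + Complex.I ≠ 0 := by
  intro h
  have := congrArg Complex.im h
  simp at this

lemma continuous_circlePoint : Continuous circlePoint := by
  unfold circlePoint
  exact Continuous.div (by fun_prop) (by fun_prop) ofReal_add_I_ne_zero

lemma norm_circlePoint (x : ℝ) : ‖circlePoint x‖ = 1 := by
  have h : (x : ℂ) - Complex.I = (starRingEnd ℂ) (x + Complex.I) := by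
    simp [sub_eq_add_neg]
  rw [circlePoint, norm_div, h, RCLike.norm_conj, div_self]
  exact norm_ne_zero_iff.2 (ofReal_add_I_ne_zero x)

/-- The half-angle substitution, from `e^(i arctan x) = (1 + ix) / √(1 + x²)`. The shift by `π`
makes the angle run over `(0, 2π)`, the interval used by `Real.circleAverage`. -/
lemma circleMap_two_arctan_add_pi (r x : ℝ) :
    circleMap 0 r (2 * Real.arctan x + Real.pi) = r * circlePoint x := by
  have hI := ofReal_add_I_ne_zero x
  have hpos : (0 : ℝ) < 1 + x ^ 2 := by positivity
  have hs : Real.sqrt (1 + x ^ 2) ≠ 0 := (Real.sqrt_pos.2 hpos).ne'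
  have hc : Complex.exp (Real.arctan x * Complex.I) =
      (1 + x * Complex.I) / (Real.sqrt (1 + x ^ 2) : ℝ) := by
    rw [Complex.exp_mul_I, ← Complex.ofReal_cos, ← Complex.ofReal_sin, Real.cos_arctan,
      Real.sin_arctan]
    push_cast
    field_simp
  have hsq : ((Real.sqrt (1 + x ^ 2) : ℝ) : ℂ) ^ 2 = 1 + x ^ 2 := by
    rw [← Complex.ofReal_pow, Real.sq_sqrt hpos.le]; push_cast; rfl
  have hexp : Complex.exp (((2 * Real.arctan x + Real.pi : ℝ) : ℂ) * Complex.I) =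
      -(Complex.exp (Real.arctan x * Complex.I)) ^ 2 := by
    rw [← Complex.exp_nat_mul]
    push_cast
    rw [add_mul, Complex.exp_add, Complex.exp_pi_mul_I, mul_neg_one]
    ring_nf
  rw [circleMap, zero_add, hexp, hc, circlePoint, div_pow, hsq]
  congr 1
  have h1 : (1 : ℂ) + x ^ 2 ≠ 0 := by exact_mod_cast hpos.ne'
  rw [← neg_div, div_eq_div_iff h1 hI]
  linear_combination (- (x : ℂ) ^ 3 - (x : ℂ) ^ 2 * Complex.I - 2 * x) * Complex.I_sq

lemma image_two_arctan_add_pi :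
    (fun x : ℝ => 2 * Real.arctan x + Real.pi) '' Set.univ = Set.Ioo 0 (2 * Real.pi) := by
  ext t
  simp only [Set.image_univ, Set.mem_range, Set.mem_Ioo]
  constructor
  · rintro ⟨x, rfl⟩
    have := Real.arctan_mem_Ioo x
    constructor <;> linarith [this.1, this.2]
  · rintro ⟨h0, h1⟩
    refine ⟨Real.tan ((t - Real.pi) / 2), ?_⟩
    rw [Real.arctan_tan] <;> linarith

lemma circleAverage_eq_integral_circlePoint (f : ℂ → ℝ) (r : ℝ) :
    Real.circleAverage f 0 r =
      Real.pi⁻¹ * ∫ x : ℝ, (1 + x ^ 2)⁻¹ * f (r * circlePoint x) := by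
  have hder : ∀ x ∈ (Set.univ : Set ℝ), HasDerivWithinAt
      (fun x : ℝ => 2 * Real.arctan x + Real.pi) (2 * (1 / (1 + x ^ 2))) Set.univ x := fun x _ =>
    (((Real.hasDerivAt_arctan x).const_mul 2).add_const _).hasDerivWithinAt
  have hinj : Set.InjOn (fun x : ℝ => 2 * Real.arctan x + Real.pi) Set.univ := by
    intro x _ y _ h
    have : Real.arctan x = Real.arctan y := by simpa using h
    exact Real.arctan_injective this
  have := integral_image_eq_integral_abs_deriv_smul MeasurableSet.univ hder hinj
    (fun t => f (circleMap 0 r t))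
  rw [image_two_arctan_add_pi, setIntegral_univ] at this
  rw [Real.circleAverage_def, intervalIntegral.integral_of_le (by positivity),
    integral_Ioc_eq_integral_Ioo, this, smul_eq_mul, mul_inv, mul_comm (2⁻¹ : ℝ), mul_assoc,
    ← integral_const_mul]
  congr 2
  funext x
  rw [circleMap_two_arctan_add_pi, abs_of_pos (by positivity), smul_eq_mul]
  ring

lemma one_sub_ne_zero_of_norm_lt {w : ℂ} (hw : ‖w‖ < 1) : 1 - w ≠ 0 := by
  intro h
  rw [← sub_eq_zero.1 h] at hw
  simp at hw

lemma cayley_zero : cayley 0 = Complex.I := by simp [cayley]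

lemma cayley_im_nonneg {w : ℂ} (hw : ‖w‖ ≤ 1) : 0 ≤ (cayley w).im := by
  have h : (cayley w).im = (1 - Complex.normSq w) / Complex.normSq (1 - w) := by
    rw [cayley, mul_div_assoc, Complex.I_mul_im, Complex.div_re, ← add_div]
    congr 1
    simp [Complex.normSq_apply]
    ring
  rw [h]
  refine div_nonneg ?_ (Complex.normSq_nonneg _)
  rw [Complex.normSq_eq_norm_sq]
  nlinarith [norm_nonneg w]

lemma cayley_add_I {w : ℂ} (hw : 1 - w ≠ 0) : cayley w + Complex.I = 2 * Complex.I / (1 - w) := by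
  rw [cayley]; field_simp; ring

lemma cayley_circlePoint (x : ℝ) : cayley (circlePoint x) = x := by
  have hI := ofReal_add_I_ne_zero x
  have h1 : 1 - circlePoint x = 2 * Complex.I / (x + Complex.I) := by
    rw [circlePoint]; field_simp; ring
  have h2 : 1 + circlePoint x = 2 * x / (x + Complex.I) := by
    rw [circlePoint]; field_simp; ring
  rw [cayley, h1, h2]
  field_simp

lemma one_sub_circlePoint_ne_zero (x : ℝ) : 1 - circlePoint x ≠ 0 := by
  have hI := ofReal_add_I_ne_zero x
  have h1 : 1 - circlePoint x = 2 * Complex.I / (x + Complex.I) := by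
    rw [circlePoint]; field_simp; ring
  rw [h1]
  exact div_ne_zero (by simp) hI

lemma differentiableAt_cayley {w : ℂ} (hw : 1 - w ≠ 0) : DifferentiableAt ℂ cayley w := by
  unfold cayley
  exact DifferentiableAt.div (by fun_prop) (by fun_prop) hw

lemma norm_mul_circlePoint {r : ℝ} (hr : 0 ≤ r) (x : ℝ) : ‖(r : ℂ) * circlePoint x‖ = r := by
  rw [norm_mul, norm_circlePoint, mul_one, Complex.norm_of_nonneg hr]

/-- Radial approach to a circle point `w` satisfies `|1 - w| ≤ 2 |1 - r w|`, and `cayley w + i = 2i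
/ (1 - w)`. This gives a dominating function independent of `r` for the limit `r → 1`. -/
lemma norm_cayley_mul_circlePoint_add_I_le {r : ℝ} (hr0 : 0 ≤ r) (hr1 : r < 1) (x : ℝ) :
    ‖cayley (r * circlePoint x) + Complex.I‖ ≤ 2 * ‖(x : ℂ) + Complex.I‖ := by
  set w := circlePoint x with hw
  have hn : ‖(r : ℂ) * w‖ < 1 := by rw [norm_mul_circlePoint hr0]; exact hr1
  have h1 := one_sub_ne_zero_of_norm_lt hn
  have h2 := one_sub_circlePoint_ne_zero x
  have h3 : ‖1 - w‖ ≤ 2 * ‖1 - r * w‖ := by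
    have a1 : ‖1 - w‖ ≤ ‖1 - r * w‖ + (1 - r) := by
      have : 1 - w = (1 - r * w) + ((r - 1 : ℝ) : ℂ) * w := by push_cast; ring
      rw [this]
      refine (norm_add_le _ _).trans ?_
      rw [norm_mul, norm_circlePoint, mul_one, Complex.norm_real, Real.norm_eq_abs,
        abs_of_nonpos (by linarith)]
      linarith
    have a2 : 1 - r ≤ ‖1 - r * w‖ := by
      have := norm_sub_norm_le (1 : ℂ) (r * w)
      rw [norm_mul_circlePoint hr0, norm_one] at this
      exact this
    linarith
  rw [cayley_add_I h1, ← cayley_circlePoint x, cayley_add_I h2]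
  rw [norm_div, norm_div, ← mul_div_assoc, div_le_div_iff₀ (norm_pos_iff.2 h1) (norm_pos_iff.2 h2)]
  nlinarith [norm_nonneg (2 * Complex.I)]

lemma tendsto_cayley_mul_circlePoint (x : ℝ) :
    Tendsto (fun r : ℝ => cayley (r * circlePoint x)) (𝓝[<] 1) (𝓝 (x : ℂ)) := by
  have h : Tendsto (fun r : ℝ => (r : ℂ) * circlePoint x) (𝓝[<] 1) (𝓝 (circlePoint x)) := by
    have : Continuous (fun r : ℝ => (r : ℂ) * circlePoint x) := by fun_prop
    have h2 := this.tendsto 1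
    simp only [Complex.ofReal_one, one_mul] at h2
    exact h2.mono_left nhdsWithin_le_nhds
  have h3 := (differentiableAt_cayley (one_sub_circlePoint_ne_zero x)).continuousAt.tendsto.comp h
  rwa [cayley_circlePoint] at h3

lemma eventually_mem_Ioo_zero_one : ∀ᶠ r : ℝ in 𝓝[<] 1, r ∈ Set.Ioo (0 : ℝ) 1 :=
  Ioo_mem_nhdsLT zero_lt_one

lemma norm_ofReal_add_I_rpow (x : ℝ) :
    ‖(x : ℂ) + Complex.I‖ ^ (1 / 2 : ℝ) = (1 + x ^ 2) ^ (1 / 4 : ℝ) := by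
  have : ‖(x : ℂ) + Complex.I‖ = (1 + x ^ 2) ^ (1 / 2 : ℝ) := by
    rw [← Real.sqrt_eq_rpow, Complex.norm_def, Complex.normSq_apply]
    congr 1
    simp; ring
  rw [this, ← Real.rpow_mul (by positivity)]
  norm_num

lemma integrable_inv_mul_norm_add_I_rpow :
    Integrable (fun x : ℝ => (1 + x ^ 2)⁻¹ * ‖(x : ℂ) + Complex.I‖ ^ (1 / 2 : ℝ)) := by
  have h := integrable_rpow_neg_one_add_norm_sq (E := ℝ) (μ := volume) (r := 3 / 2)
    (by simp; norm_num)
  refine h.congr (Eventually.of_forall fun x => ?_)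
  have hpos : (0 : ℝ) < 1 + x ^ 2 := by positivity
  simp only
  rw [norm_ofReal_add_I_rpow, ← Real.rpow_neg_one, ← Real.rpow_add hpos, Real.norm_eq_abs, sq_abs]
  norm_num

/-- Averages over the circles of radius `r → 1` converge to the Poisson average over `ℝ`. -/
lemma tendsto_circleAverage_cayley {h : ℂ → ℝ} {A : ℝ} (hA : 0 ≤ A)
    (hc : ∀ z : ℂ, 0 ≤ z.im → ContinuousAt h z)
    (hb : ∀ z : ℂ, 0 ≤ z.im → |h z| ≤ A * ‖z + Complex.I‖ ^ (1 / 2 : ℝ)) :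
    Tendsto (fun r => Real.circleAverage (fun w => h (cayley w)) 0 r) (𝓝[<] 1)
      (𝓝 (Real.pi⁻¹ * ∫ x : ℝ, (1 + x ^ 2)⁻¹ * h x)) := by
  simp_rw [circleAverage_eq_integral_circlePoint]
  refine Tendsto.const_mul _ ?_
  -- Growth of order `1/2` is integrable against `1 / (1 + x²)`.
  refine tendsto_integral_filter_of_dominated_convergence
    (fun x => (A * 2 ^ (1 / 2 : ℝ)) * ((1 + x ^ 2)⁻¹ * ‖(x : ℂ) + Complex.I‖ ^ (1 / 2 : ℝ)))
    ?_ ?_ (integrable_inv_mul_norm_add_I_rpow.const_mul _) ?_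
  · filter_upwards [eventually_mem_Ioo_zero_one] with r hr
    refine Continuous.aestronglyMeasurable ?_
    refine Continuous.mul (Continuous.inv₀ (by fun_prop) fun x => by positivity) ?_
    rw [continuous_iff_continuousAt]
    intro x
    have hn : ‖(r : ℂ) * circlePoint x‖ < 1 := by rw [norm_mul_circlePoint hr.1.le]; exact hr.2
    have h1 := hc _ (cayley_im_nonneg hn.le)
    have h2 := (differentiableAt_cayley (one_sub_ne_zero_of_norm_lt hn)).continuousAt
    have h3 : ContinuousAt (fun x : ℝ => (r : ℂ) * circlePoint x) x :=
      (continuous_const.mul continuous_circlePoint).continuousAt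
    exact ContinuousAt.comp (f := fun x : ℝ => cayley (r * circlePoint x)) h1
      (ContinuousAt.comp (f := fun x : ℝ => (r : ℂ) * circlePoint x) h2 h3)
  · filter_upwards [eventually_mem_Ioo_zero_one] with r hr
    refine Eventually.of_forall fun x => ?_
    have hn : ‖(r : ℂ) * circlePoint x‖ < 1 := by rw [norm_mul_circlePoint hr.1.le]; exact hr.2
    rw [norm_mul, Real.norm_of_nonneg (by positivity : (0 : ℝ) ≤ (1 + x ^ 2)⁻¹), Real.norm_eq_abs]
    calc _ ≤ (1 + x ^ 2)⁻¹ * (A * ‖cayley (r * circlePoint x) + Complex.I‖ ^ (1 / 2 : ℝ)) := by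
          gcongr; exact hb _ (cayley_im_nonneg hn.le)
      _ ≤ (1 + x ^ 2)⁻¹ * (A * (2 * ‖(x : ℂ) + Complex.I‖) ^ (1 / 2 : ℝ)) := by
          gcongr; exact norm_cayley_mul_circlePoint_add_I_le hr.1.le hr.2 x
      _ = _ := by rw [Real.mul_rpow (by norm_num) (norm_nonneg _)]; ring
  · refine Eventually.of_forall fun x => ?_
    refine Tendsto.const_mul _ ?_
    exact (hc x (by simp)).tendsto.comp (tendsto_cayley_mul_circlePoint x)

lemma differentiableAt_comp_cayley {f : ℂ → ℂ} (hf : ∀ z : ℂ, 0 ≤ z.im → DifferentiableAt ℂ f z)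
    {w : ℂ} (hw : ‖w‖ < 1) : DifferentiableAt ℂ (fun w => f (cayley w)) w :=
  DifferentiableAt.comp w (hf _ (cayley_im_nonneg hw.le))
    (differentiableAt_cayley (one_sub_ne_zero_of_norm_lt hw))

/-! ### Jensen's inequality. -/

/-- The sub-mean value property of `log |f|` on circles. -/
lemma log_norm_le_circleAverage {f : ℂ → ℂ} {r : ℝ} (hr : 0 < r)
    (hf : AnalyticOnNhd ℂ f (Metric.closedBall 0 r)) (h0 : f 0 ≠ 0) :
    Real.log ‖f 0‖ ≤ Real.circleAverage (fun w => Real.log ‖f w‖) 0 r := by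
  rw [AnalyticOnNhd.circleAverage_log_norm hr.ne' (by rwa [abs_of_pos hr]) h0]
  -- In Jensen's formula the excess is a sum over zeros `u` of multiplicity times `log (r / |u|)`,
  -- each term nonnegative.
  refine le_add_of_nonneg_left (finsum_nonneg fun u => ?_)
  rw [abs_of_pos hr]
  by_cases hu : u ∈ Metric.closedBall (0 : ℂ) r
  · refine mul_nonneg ?_ ?_
    · exact_mod_cast (MeromorphicOn.AnalyticOnNhd.divisor_nonneg hf) u
    · by_cases hu0 : u = 0
      -- Here the factor is `log (r * 0⁻¹) = log 0 = 0`.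
      · subst hu0; simp
      · refine Real.log_nonneg ?_
        rw [zero_sub, norm_neg, ← div_eq_mul_inv, one_le_div (norm_pos_iff.2 hu0)]
        simpa using hu
  · rw [Function.locallyFinsuppWithin.apply_eq_zero_of_notMem _ hu]
    simp

/-- Jensen's inequality on the upper half-plane, for the truncation of `log |f|` from below. -/
lemma log_norm_le_integral_log_max {f : ℂ → ℂ} {M N : ℝ}
    (hf : ∀ z : ℂ, 0 ≤ z.im → DifferentiableAt ℂ f z) (hM : ∀ z : ℂ, 0 ≤ z.im → ‖f z‖ ≤ M)
    (h0 : f Complex.I ≠ 0) :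
    Real.log ‖f Complex.I‖ ≤
      Real.pi⁻¹ * ∫ x : ℝ, (1 + x ^ 2)⁻¹ * Real.log (max ‖f x‖ (Real.exp (-N))) := by
  have hmax : ∀ z, 0 < max ‖f z‖ (Real.exp (-N)) := fun z => lt_max_of_lt_right (Real.exp_pos _)
  have hlow : ∀ z, -N ≤ Real.log (max ‖f z‖ (Real.exp (-N))) := fun z => by
    rw [Real.le_log_iff_exp_le (hmax z)]; exact le_max_right _ _
  refine ge_of_tendsto (tendsto_circleAverage_cayley
    (h := fun z => Real.log (max ‖f z‖ (Real.exp (-N))))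
    (A := max |N| |Real.log (max M (Real.exp (-N)))|) (by positivity) ?_ ?_) ?_
  · intro z hz
    exact ContinuousAt.log ((hf z hz).continuousAt.norm.max continuousAt_const) (hmax z).ne'
  · intro z hz
    have h1 : 1 ≤ ‖z + Complex.I‖ ^ (1 / 2 : ℝ) := by
      refine Real.one_le_rpow ?_ (by norm_num)
      refine le_trans ?_ (Complex.abs_im_le_norm _)
      rw [Complex.add_im, Complex.I_im, abs_of_nonneg (by linarith)]
      linarith
    refine le_trans ?_ (le_mul_of_one_le_right (by positivity) h1)
    have hup : Real.log (max ‖f z‖ (Real.exp (-N))) ≤ Real.log (max M (Real.exp (-N))) :=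
      Real.log_le_log (hmax z) (max_le_max_right _ (hM z hz))
    rw [abs_le]
    constructor
    · have := le_max_left |N| |Real.log (max M (Real.exp (-N)))|
      linarith [hlow z, le_abs_self N]
    · exact hup.trans ((le_abs_self _).trans (le_max_right _ _))
  · filter_upwards [eventually_mem_Ioo_zero_one] with r hr
    have hsub : ∀ w ∈ Metric.closedBall (0 : ℂ) r, ‖w‖ < 1 := fun w hw =>
      lt_of_le_of_lt (by simpa using hw) hr.2
    have han : AnalyticOnNhd ℂ (fun w => f (cayley w)) (Metric.closedBall 0 r) := by
      have : DifferentiableOn ℂ (fun w => f (cayley w)) (Metric.ball 0 1) := fun w hw =>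
        (differentiableAt_comp_cayley hf (by simpa using hw)).differentiableWithinAt
      exact (this.analyticOnNhd Metric.isOpen_ball).mono fun w hw => by simpa using hsub w hw
    have h1 := log_norm_le_circleAverage (f := fun w => f (cayley w)) hr.1 han
      (by rwa [cayley_zero])
    rw [cayley_zero] at h1
    have hcont : ContinuousOn (fun w => Real.log (max ‖f (cayley w)‖ (Real.exp (-N))))
        (Metric.sphere 0 r) := by
      intro w hw
      have hw1 := hsub w (Metric.sphere_subset_closedBall hw)
      exact (ContinuousAt.log
        ((differentiableAt_comp_cayley hf hw1).continuousAt.norm.max continuousAt_const)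
        (hmax _).ne').continuousWithinAt
    have hmem := han.preimage_zero_mem_codiscreteWithin (x := 0)
      (by simpa [cayley_zero] using h0) (by simpa using hr.1.le)
      ⟨⟨0, by simpa using hr.1.le⟩, (convex_closedBall (0 : ℂ) r).isPreconnected⟩
    -- As `Real.log 0 = 0`, the logarithm can exceed its truncation at a zero of `f`. Taking the
    -- minimum changes it only on a discrete set and leaves the average intact.
    have hcongr : (fun w => Real.log ‖f (cayley w)‖)
        =ᶠ[codiscreteWithin (Metric.sphere 0 |r|)]
        fun w => min (Real.log ‖f (cayley w)‖)
          (Real.log (max ‖f (cayley w)‖ (Real.exp (-N)))) := by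
      rw [abs_of_pos hr.1]
      filter_upwards [codiscreteWithin_mono Metric.sphere_subset_closedBall hmem] with w hw
      rw [min_eq_left]
      exact Real.log_le_log (norm_pos_iff.2 (by simpa using hw)) (le_max_left _ _)
    rw [Real.circleAverage_congr_codiscreteWithin hcongr hr.1.ne'] at h1
    refine h1.trans (Real.circleAverage_mono ?_ (hcont.circleIntegrable hr.1.le)
      fun w _ => min_le_right _ _)
    refine CircleIntegrable.congr_codiscreteWithin hcongr
      (MeromorphicOn.circleIntegrable_log_norm_of_nonneg ?_ hr.1.le)
    exact (han.mono Metric.sphere_subset_closedBall).meromorphicOn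

/-! ### Controlling `|f|²` in mean by `(Re f)²`. -/

lemma norm_sq_eq_two_mul_re_sq_sub (z : ℂ) : ‖z‖ ^ 2 = 2 * z.re ^ 2 - (z ^ 2).re := by
  rw [← Complex.normSq_eq_norm_sq, Complex.normSq_apply, sq z, Complex.mul_re]
  ring

/-- On the upper half-plane the Poisson average of `|f|²` is controlled by that of `(Re f)²`. -/
lemma lintegral_norm_sq_le_of_re_sq_le {f : ℂ → ℂ} {A : ℝ} (hA : 0 ≤ A)
    (hf : ∀ z : ℂ, 0 ≤ z.im → DifferentiableAt ℂ f z)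
    (hb : ∀ z : ℂ, 0 ≤ z.im → (f z).re ^ 2 ≤ A * ‖z + Complex.I‖ ^ (1 / 2 : ℝ)) :
    ∫⁻ x : ℝ, ENNReal.ofReal ((1 + x ^ 2)⁻¹ * ‖f x‖ ^ 2) ≤
      ENNReal.ofReal (2 * (∫ x : ℝ, (1 + x ^ 2)⁻¹ * (f x).re ^ 2) +
        Real.pi * (f Complex.I).im ^ 2) := by
  have hre := tendsto_circleAverage_cayley (h := fun z => (f z).re ^ 2) hA
    (fun z hz => (Complex.continuous_re.continuousAt.comp (hf z hz).continuousAt).pow 2)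
    (fun z hz => by rw [abs_of_nonneg (sq_nonneg _)]; exact hb z hz)
  have hcontI : ∀ r ∈ Set.Ioo (0 : ℝ) 1,
      Continuous fun x : ℝ => f (cayley (r * circlePoint x)) := by
    intro r hr
    rw [continuous_iff_continuousAt]
    intro x
    have hn : ‖(r : ℂ) * circlePoint x‖ < 1 := by rw [norm_mul_circlePoint hr.1.le]; exact hr.2
    exact ContinuousAt.comp (f := fun x : ℝ => (r : ℂ) * circlePoint x)
      (differentiableAt_comp_cayley hf hn).continuousAt
      (continuous_const.mul continuous_circlePoint).continuousAt
  have hker : Continuous fun x : ℝ => (1 + x ^ 2)⁻¹ :=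
    Continuous.inv₀ (by fun_prop) fun x => by positivity
  have hcirc : ∀ r ∈ Set.Ioo (0 : ℝ) 1,
      ∫⁻ x : ℝ, ENNReal.ofReal ((1 + x ^ 2)⁻¹ * ‖f (cayley (r * circlePoint x))‖ ^ 2) ≤
        ENNReal.ofReal (2 * (Real.pi * Real.circleAverage (fun w => (f (cayley w)).re ^ 2) 0 r) +
          Real.pi * (f Complex.I).im ^ 2) := by
    intro r hr
    have hball : ∀ w ∈ Metric.closedBall (0 : ℂ) r, ‖w‖ < 1 := fun w hw =>
      lt_of_le_of_lt (by simpa using hw) hr.2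
    have hcont : ContinuousOn (fun w => f (cayley w)) (Metric.closedBall 0 r) := fun w hw =>
      (differentiableAt_comp_cayley hf (hball w hw)).continuousAt.continuousWithinAt
    obtain ⟨B, hB⟩ := (isCompact_closedBall (0 : ℂ) r).exists_bound_of_continuousOn hcont
    have hint : Integrable fun x : ℝ =>
        (1 + x ^ 2)⁻¹ * ‖f (cayley (r * circlePoint x))‖ ^ 2 := by
      refine (integrable_inv_one_add_sq.mul_const (B ^ 2)).mono'
        (hker.mul ((hcontI r hr).norm.pow 2)).aestronglyMeasurable
        (Eventually.of_forall fun x => ?_)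
      rw [Real.norm_of_nonneg (by positivity)]
      gcongr
      refine hB _ ?_
      rw [mem_closedBall_zero_iff, norm_mul_circlePoint hr.1.le]
    rw [← ofReal_integral_eq_lintegral_ofReal hint
      (Eventually.of_forall fun x => by positivity)]
    refine ENNReal.ofReal_le_ofReal ?_
    have h1 := circleAverage_eq_integral_circlePoint (fun w => ‖f (cayley w)‖ ^ 2) r
    have hpi := Real.pi_pos
    have hsub : Metric.sphere (0 : ℂ) r ⊆ Metric.closedBall 0 r := Metric.sphere_subset_closedBall
    have hci1 : CircleIntegrable (fun w => 2 * (f (cayley w)).re ^ 2) 0 r :=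
      ContinuousOn.circleIntegrable hr.1.le
        ((((Complex.continuous_re.comp_continuousOn hcont).pow 2).const_mul 2).mono hsub)
    have hci2 : CircleIntegrable (fun w => f (cayley w) ^ 2) 0 r :=
      ContinuousOn.circleIntegrable hr.1.le ((hcont.pow 2).mono hsub)
    have hci3 : CircleIntegrable (fun w => (f (cayley w) ^ 2).re) 0 r :=
      ContinuousOn.circleIntegrable hr.1.le
        ((Complex.continuous_re.comp_continuousOn (hcont.pow 2)).mono hsub)
    have hmean : Real.circleAverage (fun w => (f (cayley w) ^ 2).re) 0 r =
        (f Complex.I ^ 2).re := by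
      have h2 : Real.circleAverage (fun w => f (cayley w) ^ 2) 0 r = f Complex.I ^ 2 := by
        rw [circleAverage_of_differentiable_on_off_countable
          (f := fun w => f (cayley w) ^ 2) Set.countable_empty
          ((hcont.pow 2).mono (by rw [abs_of_pos hr.1])) ?_, cayley_zero]
        intro w hw
        rw [abs_of_pos hr.1] at hw
        exact (differentiableAt_comp_cayley hf
          (hball w (Metric.ball_subset_closedBall hw.1))).pow 2
      rw [← h2]
      exact Complex.reCLM.circleAverage_comp_comm hci2
    have h3 : Real.circleAverage (fun w => ‖f (cayley w)‖ ^ 2) 0 r =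
        2 * Real.circleAverage (fun w => (f (cayley w)).re ^ 2) 0 r - (f Complex.I ^ 2).re := by
      simp_rw [norm_sq_eq_two_mul_re_sq_sub]
      rw [Real.circleAverage_fun_sub hci1 hci3, hmean]
      congr 1
      exact Real.circleAverage_fun_smul (a := (2 : ℝ))
    -- Only `(Im f(i))²` survives with a positive sign in `-Re f(i)²`; the term `-(Re f(i))²` is
    -- dropped.
    have h4 : (f Complex.I ^ 2).re = (f Complex.I).re ^ 2 - (f Complex.I).im ^ 2 := by
      rw [sq, Complex.mul_re]; ring
    have h5 : ∫ x : ℝ, (1 + x ^ 2)⁻¹ * ‖f (cayley (r * circlePoint x))‖ ^ 2 =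
        Real.pi * Real.circleAverage (fun w => ‖f (cayley w)‖ ^ 2) 0 r := by
      rw [h1]; field_simp
    rw [h5, h3, h4]
    nlinarith [sq_nonneg (f Complex.I).re]
  have hlim : Tendsto (fun r => ENNReal.ofReal
      (2 * (Real.pi * Real.circleAverage (fun w => (f (cayley w)).re ^ 2) 0 r) +
        Real.pi * (f Complex.I).im ^ 2)) (𝓝[<] 1)
      (𝓝 (ENNReal.ofReal (2 * (∫ x : ℝ, (1 + x ^ 2)⁻¹ * (f x).re ^ 2) +
        Real.pi * (f Complex.I).im ^ 2))) := by
    refine ENNReal.tendsto_ofReal ?_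
    have := ((hre.const_mul Real.pi).const_mul 2).add_const (Real.pi * (f Complex.I).im ^ 2)
    rwa [mul_inv_cancel_left₀ Real.pi_ne_zero] at this
  -- Fatou along a sequence of radii replaces an integrable majorant, since only the real part has a
  -- growth bound.
  obtain ⟨ρ, -, hρ1, hρ⟩ := exists_seq_strictMono_tendsto' (zero_lt_one (α := ℝ))
  have hρ' : Tendsto ρ atTop (𝓝[<] 1) := tendsto_nhdsWithin_iff.2
    ⟨hρ, Eventually.of_forall fun n => (hρ1 n).2⟩
  rw [← (hlim.comp hρ').liminf_eq]
  calc ∫⁻ x : ℝ, ENNReal.ofReal ((1 + x ^ 2)⁻¹ * ‖f x‖ ^ 2)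
      ≤ ∫⁻ x : ℝ, liminf (fun n : ℕ => ENNReal.ofReal
          ((1 + x ^ 2)⁻¹ * ‖f (cayley (ρ n * circlePoint x))‖ ^ 2)) atTop := by
        refine lintegral_mono fun x => ?_
        refine le_of_eq (Tendsto.liminf_eq ?_).symm
        refine ENNReal.tendsto_ofReal (Tendsto.const_mul _ (Tendsto.pow (Tendsto.norm ?_) 2))
        exact (hf x (by simp)).continuousAt.tendsto.comp
          ((tendsto_cayley_mul_circlePoint x).comp hρ')
    _ ≤ liminf (fun n : ℕ => ∫⁻ x : ℝ, ENNReal.ofReal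
          ((1 + x ^ 2)⁻¹ * ‖f (cayley (ρ n * circlePoint x))‖ ^ 2)) atTop :=
        lintegral_liminf_le fun n => (hker.mul ((hcontI _ (hρ1 n)).norm.pow 2)).measurable.ennreal_ofReal
    _ ≤ _ := liminf_le_liminf (Eventually.of_forall fun n => hcirc _ (hρ1 n))

/-! ### Pointwise bound in `H¹`. -/

lemma lintegral_comp_add_mul {t : ℝ} (ht : 0 < t) (a : ℝ) (F : ℝ → ENNReal) :
    ∫⁻ x, F x = ENNReal.ofReal t * ∫⁻ x, F (a + t * x) := by
  have h := lintegral_image_eq_lintegral_abs_deriv_mul (f := fun x : ℝ => a + t * x)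
    (f' := fun _ => t) MeasurableSet.univ
    (fun x _ => by
      simpa using (((hasDerivAt_id' x).const_mul t).const_add a).hasDerivWithinAt (s := Set.univ))
    (fun x _ y _ hxy => by simpa [ht.ne'] using hxy) F
  have himg : (fun x : ℝ => a + t * x) '' Set.univ = Set.univ := by
    rw [Set.image_univ, Set.range_eq_univ]
    exact fun y => ⟨(y - a) / t, by field_simp; ring⟩
  rw [himg] at h
  simp only [Measure.restrict_univ, abs_of_pos ht] at h
  rw [h, lintegral_const_mul' _ _ ENNReal.ofReal_ne_top]

lemma ae_comp_add_mul {t : ℝ} (ht : 0 < t) (a : ℝ) {P : ℝ → Prop} (hP : ∀ᵐ x, P x) :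
    ∀ᵐ x : ℝ, P (a + t * x) := by
  rw [ae_iff] at hP ⊢
  have h1 : {x | ¬P (a + t * x)} = (fun x => t * x) ⁻¹' ((fun x => a + x) ⁻¹' {x | ¬P x}) := rfl
  rw [h1, Real.volume_preimage_mul_left ht.ne', measure_preimage_add, hP, mul_zero]

lemma isOpen_upperHalfPlane : IsOpen {z : ℂ | 0 < z.im} :=
  isOpen_lt continuous_const Complex.continuous_im

lemma enorm_mul_le_lintegral_circle {H : ℂ → ℂ} (hd : DifferentiableOn ℂ H {z | 0 < z.im})
    {z : ℂ} {r : ℝ} (hr0 : 0 < r) (hr : r < z.im) :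
    ENNReal.ofReal (2 * Real.pi) * ‖H z‖ₑ ≤
      ∫⁻ θ in Set.Ioo (-Real.pi) Real.pi, ‖H (z + Complex.polarCoord.symm (r, θ))‖ₑ := by
  have hsub : Metric.closedBall z r ⊆ {z : ℂ | 0 < z.im} := by
    intro w hw
    have h1 : |(w - z).im| ≤ r := (Complex.abs_im_le_norm _).trans (by simpa [dist_eq_norm] using hw)
    rw [Complex.sub_im, abs_le] at h1
    simp only [Set.mem_ofPred_eq]
    linarith [h1.1]
  have hmean : Real.circleAverage H z r = H z :=
    circleAverage_of_differentiable_on_off_countable Set.countable_empty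
      (hd.continuousOn.mono (by rwa [abs_of_pos hr0]))
      fun w hw => (hd.differentiableAt (isOpen_upperHalfPlane.mem_nhds
        (hsub (by rw [abs_of_pos hr0] at hw; exact Metric.ball_subset_closedBall hw.1))))
  have hint : ∫ θ in Set.Ioo (-Real.pi) Real.pi, H (z + Complex.polarCoord.symm (r, θ)) =
      (2 * Real.pi : ℝ) • H z := by
    rw [← hmean, Real.circleAverage_eq_integral_add (-Real.pi),
      smul_inv_smul₀ (by positivity),
      intervalIntegral.integral_comp_add_right (fun θ => H (circleMap z r θ)),
      intervalIntegral.integral_of_le (by linarith [Real.pi_pos]),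
      integral_Ioc_eq_integral_Ioo]
    have e : (2 * Real.pi + -Real.pi) = Real.pi := by ring
    rw [zero_add, e]
    refine setIntegral_congr_fun measurableSet_Ioo fun θ _ => ?_
    simp only [Complex.polarCoord_symm_apply, circleMap, Complex.exp_mul_I]
    push_cast
    rfl
  calc ENNReal.ofReal (2 * Real.pi) * ‖H z‖ₑ
      = ‖(2 * Real.pi : ℝ) • H z‖ₑ := by
        rw [enorm_smul, Real.enorm_of_nonneg (by positivity)]
    _ ≤ _ := by rw [← hint]; exact enorm_integral_le_lintegral_enorm _

/-- Integrate the mean value property over circles of radius in `(R/2, R)` about `z`, with `R = Im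
z`. The annulus lies in the strip `0 < Im < 2R`, where Fubini gives mass at most `2RC`. Hence `(π/2)
R² |H z| ≤ 2RC`, and `4/π < 2`. -/
lemma norm_le_of_lintegral_le_of_measurable {H : ℂ → ℂ} (hm : Measurable H)
    (hd : DifferentiableOn ℂ H {z | 0 < z.im}) {C : NNReal}
    (hC : ∀ y : ℝ, 0 < y → ∫⁻ x : ℝ, ‖H (x + y * Complex.I)‖ₑ ≤ C) {z : ℂ} (hz : 0 < z.im) :
    ‖H z‖ ≤ 2 * C / z.im := by
  set R := z.im with hR
  set F : ℂ → ENNReal := fun w => Set.indicator {w : ℂ | |w.im| < R} (fun w => ‖H (z + w)‖ₑ) w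
    with hF
  have hFm : Measurable F := by
    refine Measurable.indicator (by fun_prop) ?_
    exact (isOpen_lt (by fun_prop) continuous_const).measurableSet
  have hup : ∫⁻ w : ℂ, F w ≤ C * ENNReal.ofReal (2 * R) := by
    rw [← (Complex.volume_preserving_equiv_real_prod.symm).lintegral_comp hFm,
      Measure.volume_eq_prod, lintegral_prod_symm _ (by
        exact (hFm.comp Complex.measurableEquivRealProd.symm.measurable).aemeasurable)]
    calc ∫⁻ y : ℝ, ∫⁻ x : ℝ, F (Complex.measurableEquivRealProd.symm (x, y))
        ≤ ∫⁻ y : ℝ, Set.indicator (Set.Ioo (-R) R) (fun _ => (C : ENNReal)) y := by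
          refine lintegral_mono fun y => ?_
          by_cases hy : |y| < R
          · have hy' : y ∈ Set.Ioo (-R) R := abs_lt.1 hy
            rw [Set.indicator_of_mem hy']
            have h1 := hC (R + y) (by linarith [hy'.1])
            rw [lintegral_comp_add_mul one_pos z.re, ENNReal.ofReal_one, one_mul] at h1
            refine le_trans (le_of_eq (lintegral_congr fun x => ?_)) h1
            have : Complex.measurableEquivRealProd.symm (x, y) ∈ {w : ℂ | |w.im| < R} := by
              simpa using hy
            rw [hF]
            simp only
            rw [Set.indicator_of_mem this]
            congr 2
            apply Complex.ext <;> simp [hR]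
          · have : ∀ x : ℝ, F (Complex.measurableEquivRealProd.symm (x, y)) = 0 := fun x => by
              rw [hF]
              simp only
              rw [Set.indicator_of_notMem]
              simpa using hy
            simp_rw [this, lintegral_zero]
            exact zero_le
      _ = C * ENNReal.ofReal (2 * R) := by
          rw [lintegral_indicator_const measurableSet_Ioo, Real.volume_Ioo]
          ring_nf
  have hlow : ENNReal.ofReal (R / 2) * ENNReal.ofReal (R / 2) *
      (ENNReal.ofReal (2 * Real.pi) * ‖H z‖ₑ) ≤ ∫⁻ w : ℂ, F w := by
    rw [← Complex.lintegral_comp_polarCoord_symm F]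
    calc ENNReal.ofReal (R / 2) * ENNReal.ofReal (R / 2) *
          (ENNReal.ofReal (2 * Real.pi) * ‖H z‖ₑ)
        = ∫⁻ r in Set.Ioo (R / 2) R, ENNReal.ofReal (R / 2) *
            (ENNReal.ofReal (2 * Real.pi) * ‖H z‖ₑ) := by
          rw [setLIntegral_const, Real.volume_Ioo]
          ring_nf
      _ ≤ ∫⁻ r in Set.Ioo (R / 2) R, ∫⁻ θ in Set.Ioo (-Real.pi) Real.pi,
            ENNReal.ofReal r • F (Complex.polarCoord.symm (r, θ)) := by
          refine setLIntegral_mono' measurableSet_Ioo fun r hr => ?_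
          have hr0 : 0 < r := lt_trans (by positivity) hr.1
          simp only [smul_eq_mul]
          rw [lintegral_const_mul' _ _ ENNReal.ofReal_ne_top]
          refine mul_le_mul' (ENNReal.ofReal_le_ofReal hr.1.le) ?_
          refine (enorm_mul_le_lintegral_circle hd hr0 hr.2).trans (le_of_eq ?_)
          refine lintegral_congr fun θ => ?_
          rw [hF]
          simp only
          rw [Set.indicator_of_mem]
          refine lt_of_le_of_lt (Complex.abs_im_le_norm _) ?_
          rw [Complex.norm_polarCoord_symm, abs_of_pos hr0]
          exact hr.2
      _ = ∫⁻ p in Set.Ioo (R / 2) R ×ˢ Set.Ioo (-Real.pi) Real.pi,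
            ENNReal.ofReal p.1 • F (Complex.polarCoord.symm p) := by
          rw [Measure.volume_eq_prod, ← Measure.prod_restrict, lintegral_prod]
          have hcont : Measurable fun p : ℝ × ℝ => Complex.polarCoord.symm p := by
            simp only [Complex.polarCoord_symm_apply]
            fun_prop
          simp only [smul_eq_mul]
          exact ((ENNReal.measurable_ofReal.comp measurable_fst).mul (hFm.comp hcont)).aemeasurable
      _ ≤ _ := by
          refine lintegral_mono_set ?_
          rw [polarCoord_target]
          exact Set.prod_mono (fun r hr => lt_trans (by positivity) hr.1) subset_rfl
  have h := hlow.trans hup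
  rw [← ofReal_norm, ← ENNReal.ofReal_mul (by positivity),
    ← ENNReal.ofReal_mul (by positivity), ← ENNReal.ofReal_mul (by positivity),
    ← ENNReal.ofReal_coe_nnreal, ← ENNReal.ofReal_mul C.coe_nonneg,
    ENNReal.ofReal_le_ofReal_iff (by positivity)] at h
  rw [le_div_iff₀ hz]
  have h2 : R * (‖H z‖ * R * Real.pi) ≤ R * (4 * C) := by nlinarith
  have h3 := le_of_mul_le_mul_left h2 hz
  have h4 : 0 ≤ ‖H z‖ * R := by positivity
  nlinarith [Real.pi_gt_three]

/-- Pointwise bound for functions in the Hardy space `H¹` of the upper half-plane. -/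
lemma norm_le_of_lintegral_le {H : ℂ → ℂ} (hd : DifferentiableOn ℂ H {z | 0 < z.im}) {C : NNReal}
    (hC : ∀ y : ℝ, 0 < y → ∫⁻ x : ℝ, ‖H (x + y * Complex.I)‖ₑ ≤ C) {z : ℂ} (hz : 0 < z.im) :
    ‖H z‖ ≤ 2 * C / z.im := by
  classical
  set U : Set ℂ := {z | 0 < z.im} with hU
  have heq : Set.EqOn (U.piecewise H 0) H U := fun w hw => Set.piecewise_eq_of_mem _ _ _ hw
  have hm : Measurable (U.piecewise H 0) :=
    hd.continuousOn.measurable_piecewise continuousOn_const isOpen_upperHalfPlane.measurableSet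
  have h := norm_le_of_lintegral_le_of_measurable hm (hd.congr heq) (C := C) (fun y hy => ?_) hz
  · rwa [heq hz] at h
  · refine le_trans (le_of_eq (lintegral_congr fun x => ?_)) (hC y hy)
    rw [heq (by simpa [hU] using hy)]

/-! ### Uniqueness in `H¹` from boundary values. -/

/-- Apply truncated Jensen to `H(· + iε)`. The positive part of the logarithm contributes at most
`C/π`, uniformly in `ε`; as `ε → 0` the negative part tends to `-N` everywhere on the boundary, so
`log |H(i)| ≤ C/π - N`. -/
lemma eq_zero_at_I_of_boundary_eq_zero {H : ℂ → ℂ} (hd : DifferentiableOn ℂ H {z | 0 < z.im})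
    {C : NNReal} (hC : ∀ y : ℝ, 0 < y → ∫⁻ x : ℝ, ‖H (x + y * Complex.I)‖ₑ ≤ C)
    (hlim : ∀ᵐ x : ℝ, Tendsto (fun y : ℝ => H (x + y * Complex.I)) (𝓝[>] 0) (𝓝 0)) :
    H Complex.I = 0 := by
  by_contra hne
  -- Any `N > C/π - log |H(i)|` contradicts the limiting inequality; the absolute value also makes
  -- `N ≥ 0`.
  set N : ℝ := |Real.pi⁻¹ * C - Real.log ‖H Complex.I‖| + 1 with hN
  have hN0 : 0 ≤ N := by positivity
  set ψ : ℝ → ℝ := fun a => Real.log (max a (Real.exp (-N))) with hψ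
  have hmax : ∀ a : ℝ, 0 < max a (Real.exp (-N)) := fun a => lt_max_of_lt_right (Real.exp_pos _)
  have hψc : Continuous ψ :=
    Continuous.log (continuous_id.max continuous_const) fun a => (hmax a).ne'
  have hψlow : ∀ a, -N ≤ ψ a := fun a => by
    rw [hψ]; simp only
    rw [Real.le_log_iff_exp_le (hmax a)]; exact le_max_right _ _
  have hψ0 : ψ 0 = -N := by
    rw [hψ]; simp only
    rw [max_eq_right (Real.exp_pos _).le, Real.log_exp]
  have hψle : ∀ a, 0 ≤ a → ψ a ≤ a + min (ψ a) 0 := fun a ha => by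
    rcases le_total (ψ a) 0 with h | h
    · rw [min_eq_left h]; linarith
    · rw [min_eq_right h, add_zero]
      rcases le_total a (Real.exp (-N)) with h1 | h1
      · have : ψ a = -N := by
          rw [hψ]; simp only
          rw [max_eq_right h1, Real.log_exp]
        linarith
      · have : ψ a = Real.log a := by rw [hψ]; simp only; rw [max_eq_left h1]
        rw [this]
        have := Real.log_le_sub_one_of_pos (lt_of_lt_of_le (Real.exp_pos _) h1)
        linarith
  set ε : ℕ → ℝ := fun n => 1 / ((n : ℝ) + 1) with hε
  have hεpos : ∀ n, 0 < ε n := fun n => by positivity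
  have hεlim : Tendsto ε atTop (𝓝[>] 0) := tendsto_nhdsWithin_iff.2
    ⟨tendsto_one_div_add_atTop_nhds_zero_nat, Eventually.of_forall hεpos⟩
  -- The upward shift makes the function bounded, and analytic across the real line, as Jensen
  -- requires.
  set f : ℕ → ℂ → ℂ := fun n z => H (z + ε n * Complex.I) with hf
  have him : ∀ n (z : ℂ), (z + ε n * Complex.I).im = z.im + ε n := fun n z => by simp
  have hfd : ∀ n (z : ℂ), 0 ≤ z.im → DifferentiableAt ℂ (f n) z := fun n z hz => by
    have h1 : DifferentiableAt ℂ H (z + ε n * Complex.I) :=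
      hd.differentiableAt (isOpen_upperHalfPlane.mem_nhds (by
        simp only [Set.mem_ofPred_eq]; rw [him]; linarith [hεpos n]))
    exact DifferentiableAt.comp (f := fun z => z + ε n * Complex.I) z h1 (by fun_prop)
  have hfb : ∀ n (z : ℂ), 0 ≤ z.im → ‖f n z‖ ≤ 2 * C / ε n := fun n z hz => by
    refine (norm_le_of_lintegral_le hd hC (z := z + ε n * Complex.I) ?_).trans ?_
    · rw [him]; linarith [hεpos n]
    · rw [him]
      have := hεpos n
      gcongr
      linarith
  have hfcont : ∀ n, Continuous fun x : ℝ => f n x := fun n => by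
    rw [continuous_iff_continuousAt]
    intro x
    exact ContinuousAt.comp (f := fun x : ℝ => (x : ℂ)) (hfd n x (by simp)).continuousAt
      Complex.continuous_ofReal.continuousAt
  have hker : Continuous fun x : ℝ => (1 + x ^ 2)⁻¹ :=
    Continuous.inv₀ (by fun_prop) fun x => by positivity
  have hfint : ∀ n, Integrable fun x : ℝ => f n x := fun n =>
    ⟨(hfcont n).aestronglyMeasurable, lt_of_le_of_lt (hC _ (hεpos n)) ENNReal.coe_lt_top⟩
  have hfint_le : ∀ n, ∫ x : ℝ, ‖f n x‖ ≤ C := fun n => by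
    rw [integral_norm_eq_lintegral_enorm (hfcont n).aestronglyMeasurable]
    exact ENNReal.toReal_le_of_le_ofReal C.coe_nonneg (by
      rw [ENNReal.ofReal_coe_nnreal]; exact hC _ (hεpos n))
  have hminb : ∀ a, ‖min (ψ a) 0‖ ≤ N := fun a => by
    rw [Real.norm_eq_abs, abs_of_nonpos (min_le_right _ _), neg_le]
    exact le_min (hψlow a) (by linarith)
  have hint1 : ∀ n, Integrable fun x : ℝ => (1 + x ^ 2)⁻¹ * ‖f n x‖ := fun n => by
    refine (hfint n).norm.mono' (hker.mul (hfcont n).norm).aestronglyMeasurable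
      (Eventually.of_forall fun x => ?_)
    rw [Real.norm_of_nonneg (by positivity)]
    refine mul_le_of_le_one_left (norm_nonneg _) (inv_le_one_of_one_le₀ ?_)
    nlinarith [sq_nonneg x]
  have hmeas2 : ∀ n, AEStronglyMeasurable
      (fun x : ℝ => (1 + x ^ 2)⁻¹ * min (ψ ‖f n x‖) 0) := fun n =>
    (hker.mul ((hψc.comp (hfcont n).norm).min continuous_const)).aestronglyMeasurable
  have hb2 : ∀ n (x : ℝ), ‖(1 + x ^ 2)⁻¹ * min (ψ ‖f n x‖) 0‖ ≤ (1 + x ^ 2)⁻¹ * N := fun n x => by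
    rw [norm_mul, Real.norm_of_nonneg (by positivity : (0 : ℝ) ≤ (1 + x ^ 2)⁻¹)]
    gcongr
    exact hminb _
  have hint2 : ∀ n, Integrable fun x : ℝ => (1 + x ^ 2)⁻¹ * min (ψ ‖f n x‖) 0 := fun n =>
    (integrable_inv_one_add_sq.mul_const N).mono' (hmeas2 n) (Eventually.of_forall (hb2 n))
  have hint3 : ∀ n, Integrable fun x : ℝ => (1 + x ^ 2)⁻¹ * ψ ‖f n x‖ := fun n => by
    refine ((hint1 n).add (integrable_inv_one_add_sq.mul_const N)).mono'
      (hker.mul (hψc.comp (hfcont n).norm)).aestronglyMeasurable (Eventually.of_forall fun x => ?_)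
    simp only [Pi.add_apply]
    rw [norm_mul, Real.norm_of_nonneg (by positivity : (0 : ℝ) ≤ (1 + x ^ 2)⁻¹), ← mul_add]
    refine mul_le_mul_of_nonneg_left (abs_le.2 ⟨?_, ?_⟩) (by positivity)
    · linarith [hψlow ‖f n x‖, norm_nonneg (f n x)]
    · linarith [hψle _ (norm_nonneg (f n x)), min_le_right (ψ ‖f n x‖) 0]
  have hcI : Tendsto (fun n => f n Complex.I) atTop (𝓝 (H Complex.I)) := by
    have h1 : ContinuousAt H Complex.I :=
      (hd.differentiableAt (isOpen_upperHalfPlane.mem_nhds (by simp))).continuousAt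
    refine h1.tendsto.comp ?_
    have : Tendsto (fun n => Complex.I + (ε n : ℂ) * Complex.I) atTop
        (𝓝 (Complex.I + ((0 : ℝ) : ℂ) * Complex.I)) :=
      ((Complex.continuous_ofReal.tendsto 0).comp
        (tendsto_nhdsWithin_iff.1 hεlim).1).mul_const _ |>.const_add _
    simpa using this
  have hJ : ∀ᶠ n in atTop, Real.log ‖f n Complex.I‖ ≤
      Real.pi⁻¹ * (C + ∫ x : ℝ, (1 + x ^ 2)⁻¹ * min (ψ ‖f n x‖) 0) := by
    filter_upwards [hcI.eventually_ne hne] with n hn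
    refine (log_norm_le_integral_log_max (N := N) (hfd n) (hfb n) hn).trans ?_
    refine mul_le_mul_of_nonneg_left ?_ (by positivity)
    calc ∫ x : ℝ, (1 + x ^ 2)⁻¹ * Real.log (max ‖f n x‖ (Real.exp (-N)))
        ≤ ∫ x : ℝ, ((1 + x ^ 2)⁻¹ * ‖f n x‖ + (1 + x ^ 2)⁻¹ * min (ψ ‖f n x‖) 0) := by
          refine integral_mono (hint3 n) ((hint1 n).add (hint2 n)) fun x => ?_
          simp only
          rw [← mul_add]
          exact mul_le_mul_of_nonneg_left (hψle _ (norm_nonneg _)) (by positivity)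
      _ ≤ _ := by
          rw [integral_add (hint1 n) (hint2 n)]
          refine add_le_add_left ?_ _
          refine (integral_mono (hint1 n) (hfint n).norm fun x => ?_).trans (hfint_le n)
          refine mul_le_of_le_one_left (norm_nonneg _) (inv_le_one_of_one_le₀ ?_)
          nlinarith [sq_nonneg x]
  have hlim2 : Tendsto (fun n => ∫ x : ℝ, (1 + x ^ 2)⁻¹ * min (ψ ‖f n x‖) 0) atTop
      (𝓝 (∫ x : ℝ, (1 + x ^ 2)⁻¹ * (-N))) := by
    refine tendsto_integral_of_dominated_convergence _ hmeas2
      (integrable_inv_one_add_sq.mul_const N) (fun n => Eventually.of_forall (hb2 n)) ?_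
    filter_upwards [hlim] with x hx
    refine Tendsto.const_mul _ ?_
    have h1 := (hx.comp hεlim).norm
    rw [norm_zero] at h1
    have h2 : Continuous fun a => min (ψ a) 0 := hψc.min continuous_const
    have h3 := (h2.tendsto 0).comp h1
    rw [hψ0, min_eq_left (by linarith)] at h3
    exact h3
  have hfinal := le_of_tendsto_of_tendsto (hcI.norm.log (norm_ne_zero_iff.2 hne))
    ((hlim2.const_add (C : ℝ)).const_mul Real.pi⁻¹) hJ
  rw [integral_mul_const, integral_univ_inv_one_add_sq, mul_add, mul_neg, mul_neg,
    inv_mul_cancel_left₀ Real.pi_ne_zero] at hfinal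
  have := le_abs_self (Real.pi⁻¹ * C - Real.log ‖H Complex.I‖)
  linarith

/-- A function in `H¹` of the upper half-plane with zero boundary values vanishes. -/
lemma eq_zero_of_boundary_eq_zero {H : ℂ → ℂ} (hd : DifferentiableOn ℂ H {z | 0 < z.im})
    {C : NNReal} (hC : ∀ y : ℝ, 0 < y → ∫⁻ x : ℝ, ‖H (x + y * Complex.I)‖ₑ ≤ C)
    (hlim : ∀ᵐ x : ℝ, Tendsto (fun y : ℝ => H (x + y * Complex.I)) (𝓝[>] 0) (𝓝 0))
    {z : ℂ} (hz : 0 < z.im) : H z = 0 := by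
  set t := z.im with ht
  have key := eq_zero_at_I_of_boundary_eq_zero (H := fun w => H (z.re + t * w))
    (C := Real.toNNReal t⁻¹ * C) ?_ ?_ ?_
  · have : (z.re : ℂ) + t * Complex.I = z := Complex.re_add_im z
    simpa [this] using key
  · refine hd.comp (by fun_prop) fun w hw => ?_
    simpa using mul_pos hz hw
  · intro y hy
    have h := hC (t * y) (mul_pos hz hy)
    rw [lintegral_comp_add_mul hz z.re] at h
    rw [ENNReal.coe_mul]
    calc ∫⁻ x : ℝ, ‖H (z.re + t * (x + y * Complex.I))‖ₑ
        = ENNReal.ofReal t⁻¹ * (ENNReal.ofReal t *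
            ∫⁻ x : ℝ, ‖H (((z.re + t * x : ℝ) : ℂ) + ((t * y : ℝ) : ℂ) * Complex.I)‖ₑ) := by
          rw [← mul_assoc, ← ENNReal.ofReal_mul (by positivity), inv_mul_cancel₀ hz.ne',
            ENNReal.ofReal_one, one_mul]
          refine lintegral_congr fun x => ?_
          congr 2
          push_cast; ring
      _ ≤ _ := by gcongr; exact le_of_eq rfl
  · filter_upwards [ae_comp_add_mul hz z.re hlim] with x hx
    have h1 : Tendsto (fun y : ℝ => t * y) (𝓝[>] 0) (𝓝[>] 0) := by
      refine tendsto_nhdsWithin_iff.2 ⟨?_, ?_⟩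
      · have : Continuous fun y : ℝ => t * y := by fun_prop
        have := this.tendsto 0
        rw [mul_zero] at this
        exact this.mono_left nhdsWithin_le_nhds
      · filter_upwards [self_mem_nhdsWithin] with y hy using mul_pos hz hy
    refine (hx.comp h1).congr fun y => ?_
    simp only [Function.comp]
    congr 1
    push_cast; ring

/-! ### Growth and weighted `L²` bounds for a logarithm. -/

/-- Borel–Carathéodory for `f - f c`, whose real part is at most `2M`, gives `4M` on the circle of
radius `R/2`; Cauchy's estimate there gives `8M/R`. -/
lemma norm_deriv_le_of_abs_re_le {f : ℂ → ℂ} {c : ℂ} {R M : ℝ} (hR : 0 < R) (hM : 0 < M)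
    (hf : DifferentiableOn ℂ f (Metric.ball c R))
    (hb : ∀ z ∈ Metric.ball c R, |(f z).re| ≤ M) : ‖deriv f c‖ ≤ 8 * M / R := by
  have hc : c ∈ Metric.ball c R := Metric.mem_ball_self hR
  have hmaps : Set.MapsTo (fun z => c + z) (Metric.ball 0 R) (Metric.ball c R) := fun z hz => by
    simpa using hz
  have hsub : Metric.closedBall c (R / 2) ⊆ Metric.ball c R :=
    Metric.closedBall_subset_ball (by linarith)
  have hBC : ∀ z ∈ Metric.sphere c (R / 2), ‖f z - f c‖ ≤ 4 * M := by
    intro z hz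
    have hz' : ‖z - c‖ = R / 2 := by simpa [dist_eq_norm] using hz
    have := Complex.borelCaratheodory_zero (f := fun w => f (c + w) - f c) (M := 2 * M) (R := R)
      (z := z - c) (by positivity)
      ((hf.comp (by fun_prop) hmaps).sub_const _) (fun w hw => ?_) hR
      (by rw [mem_ball_zero_iff, hz']; linarith) (by simp)
    · rw [hz', add_sub_cancel] at this
      refine this.trans (le_of_eq ?_)
      field_simp
      ring
    · have h1 := abs_le.1 (hb _ (hmaps hw))
      have h2 := abs_le.1 (hb _ hc)
      simp only [Set.mem_ofPred_eq, Complex.sub_re]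
      linarith [h1.2, h2.1]
  have h := Complex.norm_deriv_le_of_forall_mem_sphere_norm_le (c := c) (R := R / 2)
    (f := fun z => f z - f c) (by positivity) ?_ hBC
  · rw [deriv_sub_const] at h
    refine h.trans (le_of_eq ?_)
    field_simp
    ring
  · refine DifferentiableOn.diffContOnCl ?_
    rw [closure_ball _ (by positivity)]
    exact (hf.mono hsub).sub_const _

lemma one_le_norm_add_I {z : ℂ} (hz : 0 ≤ z.im) : 1 ≤ ‖z + Complex.I‖ := by
  refine le_trans ?_ (Complex.abs_im_le_norm _)
  rw [Complex.add_im, Complex.I_im, abs_of_nonneg (by linarith)]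
  linarith

section ExpHardy

variable {L : ℂ → ℂ}

/-- The pointwise `H¹` bound gives `Re L ≤ log (2C/δ) + 2 log |z + i|`, and `log m ≤ 4 m^(1/4)`. The
exponent is `1/4` so that the square has the growth `1/2` admitted in the Poisson limit. -/
lemma re_le_of_exp_hardy (hL : DifferentiableOn ℂ L {z | 0 < z.im}) {C : NNReal}
    (hC : ∀ y : ℝ, 0 < y →
      ∫⁻ x : ℝ, ‖Complex.exp (L (x + y * Complex.I)) / (x + y * Complex.I + Complex.I) ^ 2‖ₑ ≤ C)
    {δ : ℝ} (hδ : 0 < δ) :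
    ∃ B : ℝ, 0 ≤ B ∧ ∀ z : ℂ, δ ≤ z.im → (L z).re ≤ B * ‖z + Complex.I‖ ^ (1 / 4 : ℝ) := by
  refine ⟨|Real.log (2 * C / δ)| + 8, by positivity, fun z hz => ?_⟩
  have hz0 : 0 < z.im := lt_of_lt_of_le hδ hz
  have hne : ∀ w : ℂ, 0 < w.im → w + Complex.I ≠ 0 := fun w hw =>
    norm_pos_iff.1 (lt_of_lt_of_le one_pos (one_le_norm_add_I hw.le))
  have hd : DifferentiableOn ℂ (fun z => Complex.exp (L z) / (z + Complex.I) ^ 2)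
      {z | 0 < z.im} :=
    DifferentiableOn.div hL.cexp (by fun_prop) fun w hw => pow_ne_zero 2 (hne w hw)
  have h1 := norm_le_of_lintegral_le hd hC hz0
  have hn := one_le_norm_add_I hz0.le
  set m := ‖z + Complex.I‖ with hm
  have hm0 : 0 < m := by linarith
  rw [norm_div, norm_pow, ← hm, Complex.norm_exp, div_le_iff₀ (by positivity)] at h1
  have h2 : Real.exp (L z).re ≤ 2 * C / δ * m ^ 2 :=
    h1.trans (by gcongr)
  have hC0 : 0 < 2 * C / δ := by
    by_contra hneg
    have h3 : 2 * C / δ * m ^ 2 ≤ 0 := mul_nonpos_of_nonpos_of_nonneg (not_lt.1 hneg) (by positivity)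
    linarith [Real.exp_pos (L z).re]
  have h3 : (L z).re ≤ Real.log (2 * C / δ) + 2 * Real.log m := by
    have := (Real.le_log_iff_exp_le (by positivity)).2 h2
    rwa [Real.log_mul hC0.ne' (by positivity), Real.log_pow] at this
  have h4 : Real.log m ≤ m ^ (1 / 4 : ℝ) / (1 / 4) := Real.log_le_rpow_div hm0.le (by norm_num)
  have h5 : 1 ≤ m ^ (1 / 4 : ℝ) := Real.one_le_rpow hn (by norm_num)
  have h6 := le_abs_self (Real.log (2 * C / δ))
  have h7 := abs_nonneg (Real.log (2 * C / δ))
  nlinarith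

lemma abs_re_le_of_exp_hardy (hL : DifferentiableOn ℂ L {z | 0 < z.im}) {C C' : NNReal}
    (hC : ∀ y : ℝ, 0 < y →
      ∫⁻ x : ℝ, ‖Complex.exp (L (x + y * Complex.I)) / (x + y * Complex.I + Complex.I) ^ 2‖ₑ ≤ C)
    (hC' : ∀ y : ℝ, 0 < y →
      ∫⁻ x : ℝ, ‖Complex.exp (-L (x + y * Complex.I)) / (x + y * Complex.I + Complex.I) ^ 2‖ₑ ≤ C')
    {δ : ℝ} (hδ : 0 < δ) :
    ∃ B : ℝ, 0 < B ∧ ∀ z : ℂ, δ ≤ z.im → |(L z).re| ≤ B * ‖z + Complex.I‖ ^ (1 / 4 : ℝ) := by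
  obtain ⟨B, hB0, hB⟩ := re_le_of_exp_hardy hL hC hδ
  obtain ⟨B', hB0', hB'⟩ := re_le_of_exp_hardy (L := fun z => -L z) hL.neg hC' hδ
  refine ⟨B + B' + 1, by positivity, fun z hz => abs_le.2 ⟨?_, ?_⟩⟩
  all_goals
    have h1 := hB z hz
    have h2 := hB' z hz
    rw [Complex.neg_re] at h2
    have h3 : 0 ≤ ‖z + Complex.I‖ ^ (1 / 4 : ℝ) := by positivity
    nlinarith [mul_nonneg hB0 h3, mul_nonneg hB0' h3]

/-- Parametrize the imaginary axis by `i s²`. On the disc of radius `s²/2` the real part is at most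
`2Bs`, so `|L'| ≤ 32B/s`; the chain rule cancels the `s`, and `s ↦ L(i s²)` is Lipschitz. -/
lemma norm_mul_I_le_of_exp_hardy (hL : DifferentiableOn ℂ L {z | 0 < z.im}) {C C' : NNReal}
    (hC : ∀ y : ℝ, 0 < y →
      ∫⁻ x : ℝ, ‖Complex.exp (L (x + y * Complex.I)) / (x + y * Complex.I + Complex.I) ^ 2‖ₑ ≤ C)
    (hC' : ∀ y : ℝ, 0 < y →
      ∫⁻ x : ℝ, ‖Complex.exp (-L (x + y * Complex.I)) / (x + y * Complex.I + Complex.I) ^ 2‖ₑ ≤ C') :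
    ∃ D : ℝ, 0 ≤ D ∧ ∀ s : ℝ, 1 ≤ s → ‖L (((s ^ 2 : ℝ) : ℂ) * Complex.I)‖ ≤ D * s := by
  obtain ⟨B, hB0, hB⟩ := abs_re_le_of_exp_hardy hL hC hC' (δ := 1 / 2) (by norm_num)
  have hder : ∀ s : ℝ, 1 ≤ s → ‖deriv L (((s ^ 2 : ℝ) : ℂ) * Complex.I)‖ ≤ 32 * B / s := by
    intro s hs
    have hs0 : 0 < s := by linarith
    have hs2 : 1 ≤ s ^ 2 := by nlinarith
    have him : ∀ z ∈ Metric.ball (((s ^ 2 : ℝ) : ℂ) * Complex.I) (s ^ 2 / 2),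
        s ^ 2 / 2 ≤ z.im := by
      intro z hz
      have h1 := (Complex.abs_im_le_norm _).trans (by simpa [dist_eq_norm] using hz : ‖z - ((s ^ 2 : ℝ) : ℂ) * Complex.I‖ < s ^ 2 / 2).le
      rw [Complex.sub_im, Complex.im_ofReal_mul, Complex.I_im, mul_one, abs_le] at h1
      linarith [h1.1]
    have h := norm_deriv_le_of_abs_re_le (f := L) (c := ((s ^ 2 : ℝ) : ℂ) * Complex.I)
      (R := s ^ 2 / 2) (M := 2 * B * s) (by positivity) (by positivity) ?_ ?_
    · refine h.trans (le_of_eq ?_)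
      field_simp
      ring
    · exact hL.mono fun z hz => lt_of_lt_of_le (by positivity) (him z hz)
    · intro z hz
      refine (hB z (by linarith [him z hz])).trans ?_
      have hnorm : ‖z + Complex.I‖ ≤ 4 * s ^ 2 := by
        have h1 : ‖z - ((s ^ 2 : ℝ) : ℂ) * Complex.I‖ < s ^ 2 / 2 := by
          simpa [dist_eq_norm] using hz
        have h2 : z + Complex.I = (z - ((s ^ 2 : ℝ) : ℂ) * Complex.I) +
            ((s ^ 2 + 1 : ℝ) : ℂ) * Complex.I := by push_cast; ring
        rw [h2]
        refine (norm_add_le _ _).trans ?_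
        rw [norm_mul, Complex.norm_I, mul_one, Complex.norm_of_nonneg (by positivity)]
        linarith
      have h3 : ‖z + Complex.I‖ ^ (1 / 4 : ℝ) ≤ 2 * s := by
        have h41 : 1 ≤ 4 * s ^ 2 := by linarith
        calc ‖z + Complex.I‖ ^ (1 / 4 : ℝ) ≤ (4 * s ^ 2) ^ (1 / 4 : ℝ) := by gcongr
          _ ≤ (4 * s ^ 2) ^ (1 / 2 : ℝ) := Real.rpow_le_rpow_of_exponent_le h41 (by norm_num)
          _ = 2 * s := by
            rw [← Real.sqrt_eq_rpow, show 4 * s ^ 2 = (2 * s) ^ 2 by ring,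
              Real.sqrt_sq (by positivity)]
      nlinarith
  refine ⟨‖L Complex.I‖ + 64 * B, by positivity, fun s hs => ?_⟩
  have hmv := Convex.norm_image_sub_le_of_norm_hasDerivWithin_le
    (f := fun s : ℝ => L (((s ^ 2 : ℝ) : ℂ) * Complex.I))
    (f' := fun s : ℝ => deriv L (((s ^ 2 : ℝ) : ℂ) * Complex.I) * ((2 * s : ℝ) * Complex.I))
    (C := 64 * B) (s := Set.Ici 1) (x := 1) (y := s) ?_ ?_ (convex_Ici 1) (by simp) hs
  · have h1 : ‖L (((s ^ 2 : ℝ) : ℂ) * Complex.I)‖ ≤ ‖L Complex.I‖ + 64 * B * (s - 1) := by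
      rw [Real.norm_of_nonneg (by linarith)] at hmv
      simp only [one_pow, Complex.ofReal_one, one_mul] at hmv
      have := norm_sub_norm_le (L (((s ^ 2 : ℝ) : ℂ) * Complex.I)) (L Complex.I)
      linarith
    nlinarith [norm_nonneg (L Complex.I)]
  · intro s hs
    have hs0 : (0 : ℝ) < s := lt_of_lt_of_le one_pos hs
    have h1 : HasDerivAt L (deriv L (((s ^ 2 : ℝ) : ℂ) * Complex.I))
        (((s ^ 2 : ℝ) : ℂ) * Complex.I) := by
      refine (hL.differentiableAt (isOpen_upperHalfPlane.mem_nhds ?_)).hasDerivAt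
      rw [Set.mem_ofPred_eq, Complex.im_ofReal_mul, Complex.I_im]
      positivity
    have h2 : HasDerivAt (fun s : ℝ => ((s ^ 2 : ℝ) : ℂ) * Complex.I)
        ((2 * s : ℝ) * Complex.I) s := by
      have h3 : HasDerivAt (fun s : ℝ => s ^ 2) (2 * s) s := by simpa using hasDerivAt_pow 2 s
      exact h3.ofReal_comp.mul_const _
    exact (h1.comp s h2).hasDerivWithinAt
  · intro s hs
    have hs0 : (0 : ℝ) < s := lt_of_lt_of_le one_pos hs
    rw [norm_mul, norm_mul, Complex.norm_I, mul_one, Complex.norm_of_nonneg (by positivity)]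
    calc _ ≤ 32 * B / s * (2 * s) := by gcongr; exact hder s hs
      _ = 64 * B := by field_simp; ring

lemma sq_le_two_mul_exp_add_exp_neg (u : ℝ) : u ^ 2 ≤ 2 * (Real.exp u + Real.exp (-u)) := by
  rcases le_total 0 u with h | h
  · have := Real.quadratic_le_exp_of_nonneg h
    nlinarith [Real.exp_pos (-u)]
  · have := Real.quadratic_le_exp_of_nonneg (neg_nonneg.2 h)
    nlinarith [Real.exp_pos u]

lemma normSq_ofReal_add_I (x : ℝ) : ‖(x : ℂ) + Complex.I‖ ^ 2 = 1 + x ^ 2 := by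
  rw [← Complex.normSq_eq_norm_sq, Complex.normSq_apply]
  simp; ring

/-- With `X = (1+y)x` one has `X + iy + i = (1+y)(x + i)`, so the weight on the line at height `y`
becomes the Poisson weight at `i`. -/
lemma lintegral_re_sq_le_of_exp_hardy (hL : DifferentiableOn ℂ L {z | 0 < z.im}) {C C' : NNReal}
    (hC : ∀ y : ℝ, 0 < y →
      ∫⁻ x : ℝ, ‖Complex.exp (L (x + y * Complex.I)) / (x + y * Complex.I + Complex.I) ^ 2‖ₑ ≤ C)
    (hC' : ∀ y : ℝ, 0 < y →
      ∫⁻ x : ℝ, ‖Complex.exp (-L (x + y * Complex.I)) / (x + y * Complex.I + Complex.I) ^ 2‖ₑ ≤ C')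
    {y : ℝ} (hy : 0 < y) :
    ∫⁻ x : ℝ, ENNReal.ofReal ((1 + x ^ 2)⁻¹ *
      (L (((0 + (1 + y) * x : ℝ) : ℂ) + y * Complex.I)).re ^ 2) ≤
      ENNReal.ofReal ((1 + y) * (2 * (C + C'))) := by
  have hy1 : 0 < 1 + y := by linarith
  set F : ℝ → ENNReal := fun X =>
    ‖Complex.exp (L (X + y * Complex.I)) / (X + y * Complex.I + Complex.I) ^ 2‖ₑ with hF
  set F' : ℝ → ENNReal := fun X =>
    ‖Complex.exp (-L (X + y * Complex.I)) / (X + y * Complex.I + Complex.I) ^ 2‖ₑ with hF'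
  have hLc : Continuous fun X : ℝ => L (X + y * Complex.I) :=
    hL.continuousOn.comp_continuous (by fun_prop) fun X => by simpa using hy
  have hFm : Measurable F := by
    refine Measurable.enorm (Measurable.div ?_ (by fun_prop))
    exact (Complex.continuous_exp.comp hLc).measurable
  have hpt : ∀ x : ℝ, ENNReal.ofReal ((1 + x ^ 2)⁻¹ *
      (L (((0 + (1 + y) * x : ℝ) : ℂ) + y * Complex.I)).re ^ 2) ≤
      ENNReal.ofReal ((1 + y) ^ 2 * 2) * (F (0 + (1 + y) * x) + F' (0 + (1 + y) * x)) := by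
    intro x
    set X : ℝ := 0 + (1 + y) * x with hX
    have hden : (X : ℂ) + y * Complex.I + Complex.I = ((1 + y : ℝ) : ℂ) * (x + Complex.I) := by
      rw [hX]; push_cast; ring
    have hnd : ‖((X : ℂ) + y * Complex.I + Complex.I) ^ 2‖ = (1 + y) ^ 2 * (1 + x ^ 2) := by
      rw [hden, norm_pow, norm_mul, mul_pow, normSq_ofReal_add_I,
        Complex.norm_of_nonneg hy1.le]
    simp only [hF, hF']
    rw [← ofReal_norm, ← ofReal_norm, ← ENNReal.ofReal_add (norm_nonneg _) (norm_nonneg _),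
      ← ENNReal.ofReal_mul (by positivity)]
    refine ENNReal.ofReal_le_ofReal ?_
    rw [norm_div, norm_div, hnd, Complex.norm_exp, Complex.norm_exp, Complex.neg_re, ← add_div]
    have h1 := sq_le_two_mul_exp_add_exp_neg (L (X + y * Complex.I)).re
    rw [inv_mul_le_iff₀ (by positivity)]
    refine h1.trans (le_of_eq ?_)
    field_simp
  refine (lintegral_mono hpt).trans ?_
  have hFm' : Measurable fun x : ℝ => F (0 + (1 + y) * x) :=
    hFm.comp (by fun_prop : Measurable fun x : ℝ => 0 + (1 + y) * x)
  rw [lintegral_const_mul' _ _ ENNReal.ofReal_ne_top, lintegral_add_left hFm']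
  have h1 := hC y hy
  have h2 := hC' y hy
  rw [lintegral_comp_add_mul hy1 0] at h1 h2
  have e1 : ENNReal.ofReal ((1 + y) ^ 2 * 2) = ENNReal.ofReal ((1 + y) * 2) * ENNReal.ofReal (1 + y) := by
    rw [← ENNReal.ofReal_mul (by positivity)]; ring_nf
  rw [e1, mul_assoc, mul_add]
  have e2 : ENNReal.ofReal ((1 + y) * (2 * (C + C'))) =
      ENNReal.ofReal ((1 + y) * 2) * (C + C') := by
    rw [← mul_assoc, ENNReal.ofReal_mul (by positivity), ENNReal.ofReal_add C.coe_nonneg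
      C'.coe_nonneg, ENNReal.ofReal_coe_nnreal, ENNReal.ofReal_coe_nnreal]
  rw [e2]
  gcongr

/-- If `exp L` and `exp (-L)` belong to `H¹` after division by `(z + i)²`, then `L / (z + i)`
belongs to `H²`. -/
lemma exists_lintegral_div_sq_le_of_exp_hardy (hL : DifferentiableOn ℂ L {z | 0 < z.im})
    {C C' : NNReal}
    (hC : ∀ y : ℝ, 0 < y →
      ∫⁻ x : ℝ, ‖Complex.exp (L (x + y * Complex.I)) / (x + y * Complex.I + Complex.I) ^ 2‖ₑ ≤ C)
    (hC' : ∀ y : ℝ, 0 < y →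
      ∫⁻ x : ℝ, ‖Complex.exp (-L (x + y * Complex.I)) / (x + y * Complex.I + Complex.I) ^ 2‖ₑ ≤ C') :
    ∃ K : NNReal, ∀ y : ℝ, 0 < y →
      ∫⁻ x : ℝ, ‖L (x + y * Complex.I) / (x + y * Complex.I + Complex.I)‖ₑ ^ (2 : ℝ) ≤ K := by
  obtain ⟨D, hD0, hD⟩ := norm_mul_I_le_of_exp_hardy hL hC hC'
  -- After division by `1 + y`, the real part contributes `2 · 2(C + C')` and the value at `i`
  -- contributes `π D² (1+2y)/(1+y) ≤ 2π D²`.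
  refine ⟨Real.toNNReal (4 * (C + C') + Real.pi * (2 * D ^ 2)), fun y hy => ?_⟩
  have hy1 : 0 < 1 + y := by linarith
  obtain ⟨B, hB0, hB⟩ := abs_re_le_of_exp_hardy hL hC hC' hy
  set f : ℂ → ℂ := fun z => L (((1 + y : ℝ) : ℂ) * z + y * Complex.I) with hf
  have him : ∀ z : ℂ, (((1 + y : ℝ) : ℂ) * z + y * Complex.I).im = (1 + y) * z.im + y := fun z => by
    rw [Complex.add_im, Complex.im_ofReal_mul, Complex.im_ofReal_mul, Complex.I_im, mul_one]
  have hfx : ∀ x : ℝ, f x = L (((0 + (1 + y) * x : ℝ) : ℂ) + y * Complex.I) := fun x => by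
    rw [hf]; simp only; congr 1; push_cast; ring
  have hfd : ∀ z : ℂ, 0 ≤ z.im → DifferentiableAt ℂ f z := fun z hz => by
    refine DifferentiableAt.comp (f := fun z => ((1 + y : ℝ) : ℂ) * z + y * Complex.I) z
      (hL.differentiableAt (isOpen_upperHalfPlane.mem_nhds ?_)) (by fun_prop)
    rw [Set.mem_ofPred_eq, him]
    positivity
  have hS := lintegral_norm_sq_le_of_re_sq_le (f := f) (A := B ^ 2 * (1 + y) ^ (1 / 2 : ℝ))
    (by positivity) hfd fun z hz => by
      have h1 := hB (((1 + y : ℝ) : ℂ) * z + y * Complex.I) (by rw [him]; nlinarith)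
      have h2 : ((1 + y : ℝ) : ℂ) * z + y * Complex.I + Complex.I =
          ((1 + y : ℝ) : ℂ) * (z + Complex.I) := by push_cast; ring
      rw [h2, norm_mul, Complex.norm_of_nonneg hy1.le, Real.mul_rpow hy1.le (norm_nonneg _)] at h1
      rw [← sq_abs]
      refine (pow_le_pow_left₀ (abs_nonneg _) h1 2).trans (le_of_eq ?_)
      rw [mul_pow, mul_pow, ← Real.rpow_mul_natCast hy1.le, ← Real.rpow_mul_natCast (norm_nonneg _)]
      norm_num
      ring
  have hre : ∫ x : ℝ, (1 + x ^ 2)⁻¹ * (f x).re ^ 2 ≤ (1 + y) * (2 * (C + C')) := by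
    have hfc : Continuous fun x : ℝ => f x := by
      rw [continuous_iff_continuousAt]
      exact fun x => ContinuousAt.comp (f := fun x : ℝ => (x : ℂ)) (hfd x (by simp)).continuousAt
        Complex.continuous_ofReal.continuousAt
    have hker : Continuous fun x : ℝ => (1 + x ^ 2)⁻¹ :=
      Continuous.inv₀ (by fun_prop) fun x => by positivity
    have hcont : Continuous fun x : ℝ => (1 + x ^ 2)⁻¹ * (f x).re ^ 2 :=
      hker.mul ((Complex.continuous_re.comp hfc).pow 2)
    rw [integral_eq_lintegral_of_nonneg_ae (Eventually.of_forall fun x => by positivity)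
      hcont.aestronglyMeasurable]
    refine ENNReal.toReal_le_of_le_ofReal (by positivity) ?_
    simp_rw [hfx]
    exact lintegral_re_sq_le_of_exp_hardy hL hC hC' hy
  have hI : (f Complex.I).im ^ 2 ≤ D ^ 2 * (1 + 2 * y) := by
    -- The rescaling sends `i` to `(1 + 2y)i`.
    have h1 := hD (Real.sqrt (1 + 2 * y)) (Real.one_le_sqrt.2 (by linarith))
    rw [Real.sq_sqrt (by linarith)] at h1
    have h2 : f Complex.I = L (((1 + 2 * y : ℝ) : ℂ) * Complex.I) := by
      rw [hf]; simp only; congr 1; push_cast; ring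
    rw [h2, ← sq_abs]
    refine (pow_le_pow_left₀ (abs_nonneg _) ((Complex.abs_im_le_norm _).trans h1) 2).trans ?_
    rw [mul_pow, Real.sq_sqrt (by linarith)]
  rw [lintegral_comp_add_mul hy1 0]
  have hpt : ∀ x : ℝ, ‖L (((0 + (1 + y) * x : ℝ) : ℂ) + y * Complex.I) /
      (((0 + (1 + y) * x : ℝ) : ℂ) + y * Complex.I + Complex.I)‖ₑ ^ (2 : ℝ) =
      ENNReal.ofReal (((1 + y) ^ 2)⁻¹) * ENNReal.ofReal ((1 + x ^ 2)⁻¹ * ‖f x‖ ^ 2) := by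
    intro x
    have h2 : (((0 + (1 + y) * x : ℝ) : ℂ) + y * Complex.I + Complex.I) =
        ((1 + y : ℝ) : ℂ) * (x + Complex.I) := by push_cast; ring
    rw [← hfx, h2, ← ofReal_norm, ENNReal.ofReal_rpow_of_nonneg (norm_nonneg _) (by norm_num),
      ← ENNReal.ofReal_mul (by positivity), Real.rpow_two, norm_div, div_pow, norm_mul, mul_pow,
      normSq_ofReal_add_I, Complex.norm_of_nonneg hy1.le]
    congr 1
    field_simp
  simp_rw [hpt]
  rw [lintegral_const_mul' _ _ ENNReal.ofReal_ne_top, ← mul_assoc,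
    ← ENNReal.ofReal_mul (by positivity)]
  refine (mul_le_mul_right hS _).trans ?_
  rw [← ENNReal.ofReal_mul (by positivity)]
  refine ENNReal.ofReal_le_ofReal ?_
  have e : (1 + y) * ((1 + y) ^ 2)⁻¹ = (1 + y)⁻¹ := by field_simp
  rw [e, inv_mul_le_iff₀ hy1]
  have hpi := Real.pi_pos
  have h3 : Real.pi * (f Complex.I).im ^ 2 ≤ Real.pi * (D ^ 2 * (1 + 2 * y)) := by gcongr
  have h4 : Real.pi * (D ^ 2 * (1 + 2 * y)) ≤ Real.pi * (D ^ 2 * (2 * (1 + y))) := by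
    gcongr; linarith
  nlinarith

end ExpHardy

/-! ### Reduction of both half-planes to the upper one by `z ↦ ±z`. -/

lemma Side.sign_mul_self (s : Side) : s.sign * s.sign = 1 := by cases s <;> simp [Side.sign]

lemma Side.sign_sq_complex (s : Side) : (s.sign : ℂ) ^ 2 = 1 := by
  cases s <;> simp [Side.sign]

lemma Side.abs_sign (s : Side) : |s.sign| = 1 := by cases s <;> simp [Side.sign]

lemma isOpen_halfPlane (s : Side) : IsOpen (halfPlane s) :=
  isOpen_lt continuous_const (by fun_prop)

lemma convex_halfPlane (s : Side) : Convex ℝ (halfPlane s) := by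
  intro z hz w hw a b ha hb hab
  simp only [halfPlane, Set.mem_ofPred_eq] at hz hw ⊢
  have e : s.sign * (a • z + b • w).im = a * (s.sign * z.im) + b * (s.sign * w.im) := by
    simp; ring
  rw [e]
  rcases ha.eq_or_lt with rfl | ha'
  · have : b = 1 := by linarith
    subst this
    linarith
  · have := mul_pos ha' hz
    have := mul_nonneg hb hw.le
    linarith

lemma line_mem_halfPlane (s : Side) (x : ℝ) {y : ℝ} (hy : 0 < y) :
    (x : ℂ) + (s.sign * y : ℝ) * Complex.I ∈ halfPlane s := by
  simp only [halfPlane, Set.mem_ofPred_eq, Complex.add_im, Complex.ofReal_im, Complex.im_ofReal_mul,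
    Complex.I_im, zero_add, mul_one, ← mul_assoc, s.sign_mul_self, one_mul]
  exact hy

lemma lam_ne_zero {s : Side} {z : ℂ} (hz : z ∈ halfPlane s) : lam s z ≠ 0 := by
  intro h
  have h1 := congrArg Complex.im h
  simp only [lam, Complex.add_im, Complex.im_ofReal_mul, Complex.I_im, mul_one,
    Complex.zero_im] at h1
  have h2 : 0 < s.sign * z.im := hz
  have h3 : s.sign * (z.im + s.sign) = 0 := by rw [h1, mul_zero]
  rw [mul_add, s.sign_mul_self] at h3
  linarith

lemma lam_ofReal_ne_zero (s : Side) (x : ℝ) : lam s x ≠ 0 := by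
  intro h
  have h1 := congrArg Complex.im h
  simp only [lam, Complex.add_im, Complex.im_ofReal_mul, Complex.I_im, mul_one,
    Complex.zero_im, Complex.ofReal_im, zero_add] at h1
  have := s.sign_mul_self
  rw [h1] at this
  simp at this

lemma differentiable_lam (s : Side) : Differentiable ℂ (lam s) := by
  unfold lam
  fun_prop

lemma continuous_lam (s : Side) : Continuous (lam s) := (differentiable_lam s).continuous

lemma lam_sign_mul (s : Side) (z : ℂ) : lam s (s.sign * z) = s.sign * (z + Complex.I) := by
  rw [lam]; ring

lemma sign_mul_mem_halfPlane (s : Side) {z : ℂ} (hz : 0 < z.im) :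
    (s.sign : ℂ) * z ∈ halfPlane s := by
  simp only [halfPlane, Set.mem_ofPred_eq, Complex.im_ofReal_mul, ← mul_assoc, s.sign_mul_self,
    one_mul]
  exact hz

lemma sign_mul_sign_mul (s : Side) (z : ℂ) : (s.sign : ℂ) * (s.sign * z) = z := by
  rw [← mul_assoc, ← sq, s.sign_sq_complex, one_mul]

lemma lintegral_comp_sign_mul (s : Side) (F : ℝ → ENNReal) :
    ∫⁻ x, F (s.sign * x) = ∫⁻ x, F x := by
  cases s
  · simp [Side.sign]
  · simpa [Side.sign] using lintegral_neg_eq_self (μ := (volume : Measure ℝ)) F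

lemma ae_comp_sign_mul (s : Side) {P : ℝ → Prop} (hP : ∀ᵐ x, P x) :
    ∀ᵐ x : ℝ, P (s.sign * x) := by
  cases s
  · simpa [Side.sign] using hP
  · simpa [Side.sign] using
      (Measure.measurePreserving_neg (volume : Measure ℝ)).quasiMeasurePreserving.ae hP

/-- The Hardy space condition for `F`, transported to the upper half-plane. -/
lemma isHardy_iff {s : Side} {p : ℝ} {F : ℂ → ℂ} :
    IsHardy s p F ↔ DifferentiableOn ℂ (fun z => F (s.sign * z)) {z | 0 < z.im} ∧
      ∃ C : NNReal, ∀ y : ℝ, 0 < y →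
        ∫⁻ x : ℝ, ‖F (s.sign * (x + y * Complex.I))‖ₑ ^ p ≤ C := by
  have hint : ∀ y : ℝ, ∫⁻ x : ℝ, ‖F ((x : ℂ) + (s.sign * y : ℝ) * Complex.I)‖ₑ ^ p =
      ∫⁻ x : ℝ, ‖F (s.sign * (x + y * Complex.I))‖ₑ ^ p := fun y => by
    rw [← lintegral_comp_sign_mul s]
    refine lintegral_congr fun x => ?_
    congr 3
    push_cast
    ring
  simp_rw [IsHardy, hint]
  refine and_congr_left fun _ => ⟨fun h => ?_, fun h => ?_⟩
  · exact h.comp (by fun_prop) fun z hz => sign_mul_mem_halfPlane s hz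
  · have h2 : DifferentiableOn ℂ (fun z => F (s.sign * (s.sign * z))) (halfPlane s) :=
      h.comp (g := fun z => F (s.sign * z)) (f := fun z => (s.sign : ℂ) * z) (by fun_prop)
        fun z hz => by simpa [halfPlane, Complex.im_ofReal_mul] using hz
    simpa only [sign_mul_sign_mul] using h2

/-! ### Products and differences in Hardy spaces. -/

lemma IsHardy.continuous_line {s : Side} {p : ℝ} {F : ℂ → ℂ} (hF : IsHardy s p F) {y : ℝ}
    (hy : 0 < y) : Continuous fun x : ℝ => F ((x : ℂ) + (s.sign * y : ℝ) * Complex.I) :=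
  hF.1.continuousOn.comp_continuous (by fun_prop) fun x => line_mem_halfPlane s x hy

lemma IsHardy.mul {s : Side} {p q : ℝ} (hpq : p.HolderConjugate q) {F G : ℂ → ℂ}
    (hF : IsHardy s p F) (hG : IsHardy s q G) : IsHardy s 1 (fun z => F z * G z) := by
  obtain ⟨C, hC⟩ := hF.2
  obtain ⟨D, hD⟩ := hG.2
  refine ⟨hF.1.mul hG.1, C ^ (1 / p) * D ^ (1 / q), fun y hy => ?_⟩
  have h := ENNReal.lintegral_mul_le_Lp_mul_Lq volume hpq
    (hF.continuous_line hy).enorm.aemeasurable (hG.continuous_line hy).enorm.aemeasurable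
  simp only [ENNReal.rpow_one, enorm_mul]
  refine h.trans ?_
  have hp := hpq.pos
  have hq := hpq.symm.pos
  rw [ENNReal.coe_mul, ENNReal.coe_rpow_of_nonneg _ (by positivity),
    ENNReal.coe_rpow_of_nonneg _ (by positivity)]
  gcongr
  · exact hC y hy
  · exact hD y hy

lemma IsHardy.sub {s : Side} {F G : ℂ → ℂ} (hF : IsHardy s 1 F) (hG : IsHardy s 1 G) :
    IsHardy s 1 (fun z => F z - G z) := by
  obtain ⟨C, hC⟩ := hF.2
  obtain ⟨D, hD⟩ := hG.2
  refine ⟨hF.1.sub hG.1, C + D, fun y hy => ?_⟩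
  have hC' := hC y hy
  have hD' := hD y hy
  simp only [ENNReal.rpow_one] at hC' hD' ⊢
  refine (lintegral_mono fun x => enorm_sub_le).trans ?_
  rw [lintegral_add_left (hF.continuous_line hy).enorm.measurable, ENNReal.coe_add]
  exact add_le_add hC' hD'

/-- On every line `|λ|² ≥ 1 + x²`, and `(1 + x²)^(-p/2)` is integrable exactly because `p > 1`. It
is the Hölder partner that brings `G / λ` and `K / λ` into `H¹`. -/
lemma isHardy_inv_lam (s : Side) {p : ℝ} (hp : 1 < p) : IsHardy s p (fun z => (lam s z)⁻¹) := by
  have hfin := (integrable_rpow_neg_one_add_norm_sq (E := ℝ) (μ := volume) (r := p)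
    (by simpa using hp)).lintegral_lt_top
  refine ⟨(differentiable_lam s).differentiableOn.inv fun z hz => lam_ne_zero hz,
    (∫⁻ x : ℝ, ENNReal.ofReal ((1 + ‖x‖ ^ 2) ^ (-p / 2))).toNNReal, fun y hy => ?_⟩
  rw [ENNReal.coe_toNNReal hfin.ne]
  refine lintegral_mono fun x => ?_
  have hlam : 1 + ‖x‖ ^ 2 ≤ ‖lam s ((x : ℂ) + (s.sign * y : ℝ) * Complex.I)‖ ^ 2 := by
    have e : lam s ((x : ℂ) + (s.sign * y : ℝ) * Complex.I) =
        (x : ℂ) + ((s.sign * (1 + y) : ℝ) : ℂ) * Complex.I := by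
      rw [lam]; push_cast; ring
    rw [e, ← Complex.normSq_eq_norm_sq, Complex.normSq_add_mul_I, mul_pow, sq s.sign,
      s.sign_mul_self, Real.norm_eq_abs, sq_abs]
    nlinarith
  rw [← ofReal_norm, ENNReal.ofReal_rpow_of_nonneg (norm_nonneg _) (by linarith)]
  refine ENNReal.ofReal_le_ofReal ?_
  rw [norm_inv, Real.inv_rpow (norm_nonneg _), neg_div, Real.rpow_neg (by positivity)]
  refine inv_anti₀ (by positivity) ?_
  calc (1 + ‖x‖ ^ 2) ^ (p / 2)
      ≤ (‖lam s ((x : ℂ) + (s.sign * y : ℝ) * Complex.I)‖ ^ 2) ^ (p / 2) := by gcongr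
    _ = _ := by
        rw [← Real.rpow_natCast_mul (norm_nonneg _)]
        congr 1
        push_cast
        ring

/-! ### Nontangential limits and reciprocal extensions. -/

lemma tendsto_line_cone (s : Side) {a : ℝ} (ha : 0 < a) (x : ℝ) :
    Tendsto (fun y : ℝ => (x : ℂ) + (s.sign * y : ℝ) * Complex.I) (𝓝[>] 0)
      (𝓝[cone s a x] (x : ℂ)) := by
  refine tendsto_nhdsWithin_iff.2 ⟨?_, ?_⟩
  · have h : Continuous fun y : ℝ => (x : ℂ) + (s.sign * y : ℝ) * Complex.I := by fun_prop
    have h1 := h.tendsto 0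
    simp only [mul_zero, Complex.ofReal_zero, zero_mul, add_zero] at h1
    exact h1.mono_left nhdsWithin_le_nhds
  · filter_upwards [self_mem_nhdsWithin] with y hy
    have hy0 : (0 : ℝ) < y := hy
    refine ⟨line_mem_halfPlane s x hy, ?_⟩
    have h1 : ((x : ℂ) + (s.sign * y : ℝ) * Complex.I).re - x = 0 := by simp
    have h2 : ((x : ℂ) + (s.sign * y : ℝ) * Complex.I).im = s.sign * y := by simp
    rw [h1, h2, abs_zero, abs_mul, s.abs_sign, one_mul, abs_of_pos hy0]
    positivity

lemma HasNontangentialLimit.tendsto_line {s : Side} {F : ℂ → ℂ} {x : ℝ} {c : ℂ}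
    (h : HasNontangentialLimit s F x c) :
    Tendsto (fun y : ℝ => F ((x : ℂ) + (s.sign * y : ℝ) * Complex.I)) (𝓝[>] 0) (𝓝 c) :=
  (h 1 one_pos).comp (tendsto_line_cone s one_pos x)

lemma tendsto_lam_cone (s : Side) (a x : ℝ) :
    Tendsto (lam s) (𝓝[cone s a x] (x : ℂ)) (𝓝 (lam s x)) :=
  ((continuous_lam s).tendsto _).mono_left nhdsWithin_le_nhds

/-- A function in `H¹(ℂ^±)` with zero nontangential boundary values vanishes. -/
lemma IsHardy.eq_zero_of_nontangentialLimit {s : Side} {H : ℂ → ℂ} (hH : IsHardy s 1 H)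
    (hlim : ∀ᵐ x : ℝ, HasNontangentialLimit s H x 0) {z : ℂ} (hz : z ∈ halfPlane s) :
    H z = 0 := by
  obtain ⟨hd, C, hC⟩ := isHardy_iff.1 hH
  simp only [ENNReal.rpow_one] at hC
  have h := eq_zero_of_boundary_eq_zero hd hC (z := s.sign * z) ?_ ?_
  · simpa only [sign_mul_sign_mul] using h
  · filter_upwards [ae_comp_sign_mul s hlim] with x hx
    refine hx.tendsto_line.congr fun y => ?_
    congr 1
    push_cast
    ring
  · simpa [halfPlane, Complex.im_ofReal_mul] using hz

lemma IsScriptHExtension.differentiableOn {s : Side} {p : ℝ} {G : ℂ → ℂ} {g : ℝ → ℂ}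
    (h : IsScriptHExtension s p G g) : DifferentiableOn ℂ G (halfPlane s) := by
  refine (h.1.1.mul (differentiable_lam s).differentiableOn).congr fun z hz => ?_
  exact (div_mul_cancel₀ _ (lam_ne_zero hz)).symm

/-- The extensions of `g` and of `1 / g` are reciprocal to each other. -/
lemma IsScriptHExtension.mul_eq_one {s : Side} {p q : ℝ} (hpq : p.HolderConjugate q)
    {G K : ℂ → ℂ} {g : ℝ → ℂ} (hg0 : ∀ᵐ x : ℝ, g x ≠ 0) (hG : IsScriptHExtension s q G g)
    (hK : IsScriptHExtension s p K (fun x => (g x)⁻¹)) {z : ℂ} (hz : z ∈ halfPlane s) :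
    G z * K z = 1 := by
  -- This function is `(G K - 1) / λ²`.
  have hH : IsHardy s 1 (fun z => G z / lam s z * (K z / lam s z) -
      (lam s z)⁻¹ * (lam s z)⁻¹) :=
    (hG.1.mul hpq.symm hK.1).sub
      ((isHardy_inv_lam s hpq.lt).mul hpq (isHardy_inv_lam s hpq.symm.lt))
  have h := hH.eq_zero_of_nontangentialLimit ?_ hz
  · have hl := lam_ne_zero hz
    field_simp at h
    linear_combination h
  · filter_upwards [hg0, hG.2.2, hK.2.2] with x hx hGx hKx a ha
    have hl := (tendsto_lam_cone s a x).inv₀ (lam_ofReal_ne_zero s x)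
    have h1 := ((hGx a ha).mul (hKx a ha)).sub (hl.mul hl)
    have e : g x / lam s x * ((g x)⁻¹ / lam s x) - (lam s x)⁻¹ * (lam s x)⁻¹ = 0 := by
      have := lam_ofReal_ne_zero s x
      field_simp
      ring
    rwa [e] at h1

/-! ### Analytic logarithms and their boundary behaviour. -/

/-- A nonvanishing analytic function on a half-plane has an analytic logarithm. -/
lemma exists_isLogBranch {s : Side} {G : ℂ → ℂ} (hd : DifferentiableOn ℂ G (halfPlane s))
    (h0 : ∀ z ∈ halfPlane s, G z ≠ 0) : ∃ L : ℂ → ℂ, IsLogBranch s G L := by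
  have hne : (halfPlane s).Nonempty := ⟨_, line_mem_halfPlane s 0 one_pos⟩
  have hsc : IsSimplyConnected (halfPlane s) := by
    have := (convex_halfPlane s).contractibleSpace hne
    exact SimplyConnectedSpace.ofContractible _
  obtain ⟨L, hLc, hL⟩ := Complex.exists_continuousOn_eqOn_exp_comp hsc (isOpen_halfPlane s)
    hd.continuousOn (by rintro ⟨z, hz, h⟩; exact h0 z hz h)
  refine ⟨L, fun z hz => ?_, hL⟩
  have hnhds := (isOpen_halfPlane s).mem_nhds hz
  -- Lifting supplies only a continuous `L`. Where `|L w - L z| < π` the principal logarithm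
  -- recovers the increment, which gives analyticity.
  have hlocal : L =ᶠ[𝓝 z] fun w => L z + Complex.log (G w / G z) := by
    have hclose : ∀ᶠ w in 𝓝 z, ‖L w - L z‖ < Real.pi := by
      have h1 : Tendsto (fun w => ‖L w - L z‖) (𝓝 z) (𝓝 ‖L z - L z‖) :=
        ((hLc.continuousAt hnhds).tendsto.sub_const _).norm
      rw [sub_self, norm_zero] at h1
      exact h1.eventually_lt_const Real.pi_pos
    filter_upwards [hclose, hnhds] with w hw hwU
    have h1 := abs_lt.1 ((Complex.abs_im_le_norm _).trans_lt hw)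
    have h2 : G w / G z = Complex.exp (L w - L z) := by
      rw [Complex.exp_sub]
      have a1 : Complex.exp (L w) = G w := hL hwU
      have a2 : Complex.exp (L z) = G z := hL hz
      rw [a1, a2]
    rw [h2, Complex.log_exp h1.1 h1.2.le]
    ring
  refine (DifferentiableAt.congr_of_eventuallyEq ?_ hlocal).differentiableWithinAt
  have hGd := hd.differentiableAt hnhds
  have hself : G z / G z = 1 := div_self (h0 z hz)
  refine (DifferentiableAt.clog (hGd.div_const _) ?_).const_add _
  rw [hself]
  exact Complex.one_mem_slitPlane

lemma isOpen_cone (s : Side) (a x : ℝ) : IsOpen (cone s a x) := by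
  have h : IsOpen {z : ℂ | |z.re - x| < a * |z.im|} := isOpen_lt (by fun_prop) (by fun_prop)
  exact (isOpen_halfPlane s).inter h

lemma convex_cone (s : Side) (a x : ℝ) : Convex ℝ (cone s a x) := by
  have himabs : ∀ z ∈ halfPlane s, |z.im| = s.sign * z.im := fun z hz => by
    have hz' : 0 < s.sign * z.im := hz
    rw [← abs_of_pos hz', abs_mul, s.abs_sign, one_mul]
  intro z hz w hw b c hb hc hbc
  have hmem := convex_halfPlane s hz.1 hw.1 hb hc hbc
  refine ⟨hmem, ?_⟩
  have h1 := hz.2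
  have h2 := hw.2
  rw [himabs _ hmem]
  rw [himabs _ hz.1] at h1
  rw [himabs _ hw.1] at h2
  have e1 : (b • z + c • w).re - x = b * (z.re - x) + c * (w.re - x) := by
    have : c = 1 - b := by linarith
    subst this
    simp; ring
  have e2 : a * (s.sign * (b • z + c • w).im) =
      b * (a * (s.sign * z.im)) + c * (a * (s.sign * w.im)) := by
    simp; ring
  rw [e1, e2]
  refine (abs_add_le _ _).trans_lt ?_
  rw [abs_mul, abs_mul, abs_of_nonneg hb, abs_of_nonneg hc]
  rcases hb.eq_or_lt with rfl | hb'
  · have : c = 1 := by linarith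
    subst this
    linarith
  · have := mul_lt_mul_of_pos_left h1 hb'
    have := mul_le_mul_of_nonneg_left h2.le hc
    linarith

/-- Near `x` the quotient `G / c` stays in the slit plane. On the truncated cone, connected by
convexity, `L - log (G / c)` has constant exponential, hence is constant, and that constant is the
limit. -/
lemma IsLogBranch.exists_tendsto_cone {s : Side} {G L : ℂ → ℂ} (hL : IsLogBranch s G L) {a x : ℝ}
    (ha : 0 < a) {c : ℂ} (hc : c ≠ 0) (hG : Tendsto G (𝓝[cone s a x] (x : ℂ)) (𝓝 c)) :
    ∃ l : ℂ, Tendsto L (𝓝[cone s a x] (x : ℂ)) (𝓝 l) ∧ Complex.exp l = c := by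
  have hquot : Tendsto (fun z => G z / c) (𝓝[cone s a x] (x : ℂ)) (𝓝 1) := by
    simpa [hc] using hG.div_const c
  have hslit : ∀ᶠ z in 𝓝[cone s a x] (x : ℂ), G z / c ∈ Complex.slitPlane :=
    hquot.eventually (Complex.isOpen_slitPlane.mem_nhds Complex.one_mem_slitPlane)
  obtain ⟨ε, hε, hball⟩ := Metric.mem_nhdsWithin_iff.1 hslit
  set T := Metric.ball (x : ℂ) ε ∩ cone s a x with hT
  have hTo : IsOpen T := Metric.isOpen_ball.inter (isOpen_cone s a x)
  have hTc : IsPreconnected T := ((convex_ball _ _).inter (convex_cone s a x)).isPreconnected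
  have hTU : T ⊆ halfPlane s := fun z hz => hz.2.1
  have hTm : T ∈ 𝓝[cone s a x] (x : ℂ) :=
    inter_mem_nhdsWithin _ (Metric.ball_mem_nhds _ hε) |> fun h => by
      rwa [Set.inter_comm] at h
  have hGd : DifferentiableOn ℂ G T :=
    (hL.1.cexp.congr fun z hz => (hL.2 z hz).symm).mono hTU
  have hhd : DifferentiableOn ℂ (fun z => L z - Complex.log (G z / c)) T :=
    (hL.1.mono hTU).sub ((hGd.div_const c).clog fun z hz => hball hz)
  have hexp : ∀ z ∈ T, Complex.exp (L z - Complex.log (G z / c)) = c := fun z hz => by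
    rw [Complex.exp_sub, hL.2 z (hTU hz),
      Complex.exp_log (Complex.slitPlane_ne_zero (hball hz))]
    have : G z ≠ 0 := by rw [← hL.2 z (hTU hz)]; exact Complex.exp_ne_zero _
    field_simp
  obtain ⟨l, hl⟩ := hTo.exists_is_const_of_deriv_eq_zero hTc hhd fun z hz => by
    have h1 := (hhd.differentiableAt (hTo.mem_nhds hz)).hasDerivAt.cexp
    have h2 : (fun z => Complex.exp (L z - Complex.log (G z / c))) =ᶠ[𝓝 z] fun _ => c := by
      filter_upwards [hTo.mem_nhds hz] with w hw using hexp w hw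
    have h3 := h1.unique ((hasDerivAt_const z c).congr_of_eventuallyEq h2)
    exact (mul_eq_zero.1 h3).resolve_left (Complex.exp_ne_zero _)
  have hlog : Tendsto (fun z => l + Complex.log (G z / c)) (𝓝[cone s a x] (x : ℂ)) (𝓝 l) := by
    have := (hquot.clog Complex.one_mem_slitPlane).const_add l
    simpa using this
  refine ⟨l, hlog.congr' ?_, ?_⟩
  · filter_upwards [hTm] with z hz
    rw [← hl z hz]
    ring
  · have : (𝓝[cone s a x] (x : ℂ)).NeBot := (tendsto_line_cone s ha x).neBot
    obtain ⟨z, hz⟩ := nonempty_of_mem hTm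
    rw [← hl z hz, hexp z hz]

/-- A logarithm of `G` has a nontangential limit wherever `G` has a nonzero one. -/
lemma IsLogBranch.exists_nontangentialLimit {s : Side} {G L : ℂ → ℂ} (hL : IsLogBranch s G L)
    {x : ℝ} {c : ℂ} (hc : c ≠ 0) (hG : HasNontangentialLimit s G x c) :
    ∃ l : ℂ, HasNontangentialLimit s L x l ∧ Complex.exp l = c := by
  obtain ⟨l, hl, hexp⟩ := hL.exists_tendsto_cone one_pos hc (hG 1 one_pos)
  refine ⟨l, fun a ha => ?_, hexp⟩
  obtain ⟨l', hl', -⟩ := hL.exists_tendsto_cone ha hc (hG a ha)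
  -- Every cone contains the vertical ray at `x`, so the limits for different apertures agree.
  have e := tendsto_nhds_unique (hl.comp (tendsto_line_cone s one_pos x))
    (hl'.comp (tendsto_line_cone s ha x))
  rwa [e]

/-! ### The logarithm in the weighted `H²` class, and the theorem. -/

lemma IsLogBranch.isHardy_div_lam {s : Side} {G K L : ℂ → ℂ} (hL : IsLogBranch s G L)
    (hGK : ∀ z ∈ halfPlane s, G z * K z = 1)
    (hG : IsHardy s 1 (fun z => G z / lam s z * (lam s z)⁻¹))
    (hK : IsHardy s 1 (fun z => K z / lam s z * (lam s z)⁻¹)) :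
    IsHardy s 2 (fun z => L z / lam s z) := by
  obtain ⟨-, C, hC⟩ := isHardy_iff.1 hG
  obtain ⟨-, C', hC'⟩ := isHardy_iff.1 hK
  have hlam : ∀ (F : ℂ) (z : ℂ), F / lam s (s.sign * z) * (lam s (s.sign * z))⁻¹ =
      F / (z + Complex.I) ^ 2 := fun F z => by
    rw [lam_sign_mul, ← div_eq_mul_inv, div_div, ← sq, mul_pow, s.sign_sq_complex, one_mul]
  have hup : ∀ (x y : ℝ), 0 < y → (s.sign : ℂ) * (x + y * Complex.I) ∈ halfPlane s :=
    fun x y hy => sign_mul_mem_halfPlane s (by simpa using hy)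
  simp only [ENNReal.rpow_one, hlam] at hC hC'
  have hd : DifferentiableOn ℂ (fun z => L (s.sign * z)) {z | 0 < z.im} :=
    hL.1.comp (by fun_prop) fun z hz => sign_mul_mem_halfPlane s hz
  obtain ⟨B, hB⟩ := exists_lintegral_div_sq_le_of_exp_hardy hd (C := C) (C' := C')
    (fun y hy => by
      refine le_trans (le_of_eq (lintegral_congr fun x => ?_)) (hC y hy)
      simp only [hL.2 _ (hup x y hy)])
    (fun y hy => by
      refine le_trans (le_of_eq (lintegral_congr fun x => ?_)) (hC' y hy)
      rw [Complex.exp_neg, hL.2 _ (hup x y hy), eq_comm,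
        eq_inv_of_mul_eq_one_right (hGK _ (hup x y hy))])
  refine isHardy_iff.2 ⟨?_, B, fun y hy => ?_⟩
  · refine hd.div ((differentiable_lam s).comp (by fun_prop)).differentiableOn fun z hz => ?_
    exact lam_ne_zero (sign_mul_mem_halfPlane s hz)
  · refine le_trans (le_of_eq (lintegral_congr fun x => ?_)) (hB y hy)
    rw [lam_sign_mul]
    congr 1
    rw [enorm_eq_iff_norm_eq, norm_div, norm_div, norm_mul, Complex.norm_real, Real.norm_eq_abs,
      s.abs_sign, one_mul]

/-- Nontangential boundary functions of `H^p(ℂ^±)` functions lie in `L^p`. -/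
lemma IsHardy.memLp_of_nontangentialLimit {s : Side} {p : ℝ} (hp : 0 < p) {F : ℂ → ℂ}
    (hF : IsHardy s p F) {f : ℝ → ℂ} (hf : ∀ᵐ x : ℝ, HasNontangentialLimit s F x (f x)) :
    MemLp f (ENNReal.ofReal p) volume := by
  obtain ⟨C, hC⟩ := hF.2
  have hεpos : ∀ n : ℕ, 0 < 1 / ((n : ℝ) + 1) := fun n => by positivity
  have hεlim : Tendsto (fun n : ℕ => 1 / ((n : ℝ) + 1)) atTop (𝓝[>] 0) := tendsto_nhdsWithin_iff.2
    ⟨tendsto_one_div_add_atTop_nhds_zero_nat, Eventually.of_forall hεpos⟩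
  have hlim : ∀ᵐ x : ℝ, Tendsto (fun n : ℕ =>
      F ((x : ℂ) + (s.sign * (1 / ((n : ℝ) + 1)) : ℝ) * Complex.I)) atTop (𝓝 (f x)) := by
    filter_upwards [hf] with x hx using hx.tendsto_line.comp hεlim
  have hmeas : ∀ n : ℕ, AEStronglyMeasurable (fun x : ℝ =>
      F ((x : ℂ) + (s.sign * (1 / ((n : ℝ) + 1)) : ℝ) * Complex.I)) volume := fun n =>
    (hF.continuous_line (hεpos n)).aestronglyMeasurable
  refine ⟨aestronglyMeasurable_of_tendsto_ae _ hmeas hlim, ?_⟩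
  have hp0 : ENNReal.ofReal p ≠ 0 := by simpa using hp
  have hbound : ∀ n : ℕ, eLpNorm (fun x : ℝ =>
      F ((x : ℂ) + (s.sign * (1 / ((n : ℝ) + 1)) : ℝ) * Complex.I)) (ENNReal.ofReal p) volume ≤
      (C : ENNReal) ^ (1 / p) := fun n => by
    rw [eLpNorm_eq_lintegral_rpow_enorm_toReal hp0 ENNReal.ofReal_ne_top,
      ENNReal.toReal_ofReal hp.le]
    gcongr
    exact hC _ (hεpos n)
  refine (Lp.eLpNorm_lim_le_liminf_eLpNorm hmeas f hlim).trans_lt ?_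
  refine (liminf_le_of_le (a := (C : ENNReal) ^ (1 / p)) (by isBoundedDefault) fun b hb => ?_).trans_lt
    (ENNReal.rpow_lt_top_of_nonneg (by positivity) ENNReal.coe_ne_top)
  obtain ⟨n, hn⟩ := hb.exists
  exact hn.trans (hbound n)

end HalfPlaneHardy

theorem theorem6p1 (p q : ℝ) (hp : 1 < p) (hpq : 1 / p + 1 / q = 1)
    (s : HalfPlaneHardy.Side) (g : ℝ → ℂ)
    (hg0 : ∀ᵐ x : ℝ, g x ≠ 0)
    (hg : HalfPlaneHardy.MemScriptH s q g)
    (hginv : HalfPlaneHardy.MemScriptH s p (fun x => (g x)⁻¹)) :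
    ∀ G : ℂ → ℂ, HalfPlaneHardy.IsScriptHExtension s q G g →
      (∃ L : ℂ → ℂ, HalfPlaneHardy.IsLogBranch s G L) ∧
      ∀ L : ℂ → ℂ, HalfPlaneHardy.IsLogBranch s G L →
        ∃ l : ℝ → ℂ, HalfPlaneHardy.IsScriptHExtension s 2 L l ∧
          ∀ᵐ x : ℝ, Complex.exp (l x) = g x := by
  open HalfPlaneHardy in
  intro G hG
  obtain ⟨K, hK⟩ := hginv
  have hconj : p.HolderConjugate q := Real.holderConjugate_iff.2 ⟨hp, by simpa using hpq⟩
  have hGK : ∀ z ∈ halfPlane s, G z * K z = 1 := fun z hz =>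
    IsScriptHExtension.mul_eq_one hconj hg0 hG hK hz
  refine ⟨exists_isLogBranch hG.differentiableOn fun z hz =>
    left_ne_zero_of_mul_eq_one (hGK z hz), fun L hL => ?_⟩
  have hGlim : ∀ᵐ x : ℝ, HasNontangentialLimit s G x (g x) := by
    filter_upwards [hG.2.2] with x hx a ha
    have h := (hx a ha).mul (tendsto_lam_cone s a x)
    rw [div_mul_cancel₀ _ (lam_ofReal_ne_zero s x)] at h
    refine h.congr' ?_
    filter_upwards [self_mem_nhdsWithin] with z hz using div_mul_cancel₀ _ (lam_ne_zero hz.1)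
  have hex : ∀ᵐ x : ℝ, ∃ l : ℂ, HasNontangentialLimit s L x l ∧ Complex.exp l = g x := by
    filter_upwards [hg0, hGlim] with x hx hGx using hL.exists_nontangentialLimit hx hGx
  -- The right logarithm of `g x` depends on the branch `L`, so it is chosen pointwise as the limit
  -- of `L`; measurability comes later, from `l / λ` being an a.e. limit of continuous functions.
  set l : ℝ → ℂ := fun x => Classical.epsilon fun l : ℂ =>
    HasNontangentialLimit s L x l ∧ Complex.exp l = g x
  have hl : ∀ᵐ x : ℝ, HasNontangentialLimit s L x (l x) ∧ Complex.exp (l x) = g x := by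
    filter_upwards [hex] with x hx using Classical.epsilon_spec hx
  have hH : IsHardy s 2 (fun z => L z / lam s z) := hL.isHardy_div_lam hGK
    (hG.1.mul hconj.symm (isHardy_inv_lam s hp))
    (hK.1.mul hconj (isHardy_inv_lam s hconj.symm.lt))
  have hlim : ∀ᵐ x : ℝ, HasNontangentialLimit s (fun z => L z / lam s z) x (l x / lam s x) := by
    filter_upwards [hl] with x hx a ha
    exact (hx.1 a ha).div (tendsto_lam_cone s a x) (lam_ofReal_ne_zero s x)
  refine ⟨l, ⟨hH, hH.memLp_of_nontangentialLimit two_pos hlim, hlim⟩, ?_⟩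
  filter_upwards [hl] with x hx using hx.2
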